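/- Let $s>0$, $a\in\mathbb{R}$, $b>0$, and set $\mathfrak{b}:=3\pi^2/2$. For a complex-valued $u\in H^1(\mathbb{R})$ let $$\mathcal{E}_{a,b}(u):=\int_{\mathbb{R}}\Big(|u'(x)|^2+|x|^s|u(x)|^2+\frac a2|u(x)|^4-\frac b6|u(x)|^6\Big)\,\mathrm{d}x\in(-\infty,+\infty],$$ where the value is $+\infty$ if $\int_{\mathbb{R}}|x|^s|u(x)|^2\,\mathrm{d}x=+\infty$, and let $$E_{a,b}:=\inf\big\{\mathcal{E}_{a,b}(u):u\in H^1(\mathbb{R}),\ \|u\|_{L^2(\mathbb{R})}=1\big\}\in[-\infty,+\infty].$$ A ground state of $E_{a,b}$ is a function $u\in H^1(\mathbb{R})$ with $\|u\|_{L^2(\mathbb{R})}=1$ and $\mathcal{E}_{a,b}(u)=E_{a,b}$. Then: (i) If $b>\mathfrak{b}$, or $b=\mathfrak{b}$ and $a<0$, then $E_{a,b}=-\infty$. (ii) If $b<\mathfrak{b}$, or $b=\mathfrak{b}$ and $a>0$, then $E_{a,b}$ has a ground state. (iii) If $b=\mathfrak{b}$ and $a=0$, then $E_{a,b}=0$,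 but $E_{a,b}$ has no ground state. -/

import Mathlib

open MeasureTheory
open scoped ENNReal ContDiff

noncomputable section

namespace NLS

/-- `v` is a weak derivative of `u : ℝ → ℂ`: integration by parts holds against every smooth
compactly supported test function. It is only used for `u` and `v` in `L²`, where both integrals
converge absolutely. -/
def IsWeakDeriv (u v : ℝ → ℂ) : Prop :=
  ∀ φ : ℝ → ℝ, ContDiff ℝ ∞ φ → HasCompactSupport φ →
    ∫ x, deriv φ x • u x = -∫ x, φ x • v x

/-- `u` belongs to the Sobolev space `H¹(ℝ) = H¹(ℝ; ℂ)`. -/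
def MemH1 (u : ℝ → ℂ) : Prop :=
  MemLp u 2 volume ∧ ∃ v : ℝ → ℂ, MemLp v 2 volume ∧ IsWeakDeriv u v

open Classical in
/-- A representative of the weak derivative of `u ∈ H¹(ℝ)`, which is unique up to a null set
(and `0` for functions without a square integrable weak derivative). -/
def weakDeriv (u : ℝ → ℂ) : ℝ → ℂ :=
  if h : ∃ v : ℝ → ℂ, MemLp v 2 volume ∧ IsWeakDeriv u v then h.choose else 0

/-- The critical strength `3π²/2` of the quintic term. -/
def criticalMass : ℝ := 3 * Real.pi ^ 2 / 2

/-- The energy functional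
`∫ |u'|² + |x|^s |u|² + (a/2) |u|⁴ - (b/6) |u|⁶` on `H¹(ℝ)`, with values in `(-∞, +∞]`.
For `u ∈ H¹(ℝ)` the functions `|u'|²`, `|u|⁴`, `|u|⁶` are integrable; only the nonnegative
trapping term can be infinite, so it is a Lebesgue integral with values in `[0, +∞]`. -/
def energy (s a b : ℝ) (u : ℝ → ℂ) : EReal :=
  ((∫ x : ℝ, (‖weakDeriv u x‖ ^ 2 + a / 2 * ‖u x‖ ^ 4 - b / 6 * ‖u x‖ ^ 6) : ℝ) : EReal)
    + ((∫⁻ x : ℝ, ENNReal.ofReal (|x| ^ s * ‖u x‖ ^ 2) : ℝ≥0∞) : EReal)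

/-- `u ∈ H¹(ℝ)` with `‖u‖₂ = 1`. -/
def Admissible (u : ℝ → ℂ) : Prop :=
  MemH1 u ∧ eLpNorm u 2 volume = 1

/-- The ground state energy: the infimum, in the extended reals, of the energy over all
`u ∈ H¹(ℝ)` with `‖u‖₂ = 1`. -/
def groundStateEnergy (s a b : ℝ) : EReal :=
  sInf (energy s a b '' {u | Admissible u})

/-- A ground state is an admissible function that attains the infimum. -/
def IsGroundState (s a b : ℝ) (u : ℝ → ℂ) : Prop :=
  Admissible u ∧ energy s a b u = groundStateEnergy s a b

end NLS

end

/-! The theorem rests on the sharp inequality `∫ |u'|² ≥ (𝔟/6) ∫ |u|⁶` for functions of mass one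
(`Normalized.gagliardo_nirenberg`), where `𝔟/6 = (π/2)²`. It is proved without rearrangement or an
Euler-Lagrange equation. Let `m` be the cumulative mass and `θ = κ(2m - 1)` with `κ < π/2`.
Expanding `|u' + κ tan θ |u|² u|² ≥ 0` and integrating the cross term by parts leaves exactly `∫
|u'|² ≥ κ² ∫ |u|⁶`; then `κ → π/2`.

The profile with density `τ sech(πτx)` attains equality. Its energy is `(𝔟 - b)/12 τ² + (a/2) D τ +
c τ^(-s)` with `D > 0` (`energy_soliton`). As `τ → ∞` this tends to `-∞` in case (i), and to `0`
when `b = 𝔟`, `a = 0`.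

In case (ii) the inequality shows that bounded total energy forces bounded kinetic and trapping
energy (`exists_bound_of_subcritical`, `exists_bound_of_critical`). The trap prevents mass from
escaping to infinity, so a minimizing sequence has a subsequence whose limit has mass one. The
quartic and sextic terms converge along it and the other two are lower semicontinuous
(`exists_normalized_limit`), so the limit is a ground state.

In case (iii) the untrapped energy is nonnegative and the trapping energy is never zero, so the
infimum `0` is not attained. -/

namespace NLS

open Set Filter Topology

/-! ### Calculus of absolutely continuous functions -/

/-- `f'` is locally integrable and `f` is a primitive of `f'`. -/
structure IsPrimitive {E : Type*} [NormedAddCommGroup E] [NormedSpace ℝ E] (f f' : ℝ → E) :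
    Prop where
  intervalIntegrable : ∀ x y, IntervalIntegrable f' volume x y
  integral_eq : ∀ x y, ∫ t in x..y, f' t = f y - f x

namespace IsPrimitive

section General

variable {E F : Type*} [NormedAddCommGroup E] [NormedSpace ℝ E]
  [NormedAddCommGroup F] [NormedSpace ℝ F] {f f' g g' : ℝ → E}

lemma eq_add_integral (h : IsPrimitive f f') (c : ℝ) :
    f = fun x => f c + ∫ t in c..x, f' t := by
  ext x; rw [h.integral_eq]; abel

lemma continuous (h : IsPrimitive f f') : Continuous f := by
  rw [h.eq_add_integral 0]
  exact continuous_const.add (intervalIntegral.continuous_primitive h.intervalIntegrable 0)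

lemma of_integral (h : ∀ x y, IntervalIntegrable f' volume x y) (c : ℝ) (e : E) :
    IsPrimitive (fun x => e + ∫ t in c..x, f' t) f' := by
  refine ⟨h, fun x y => ?_⟩
  rw [add_sub_add_left_eq_sub, intervalIntegral.integral_interval_sub_left (h _ _) (h _ _)]

lemma add (h : IsPrimitive f f') (k : IsPrimitive g g') :
    IsPrimitive (fun x => f x + g x) (fun x => f' x + g' x) := by
  refine ⟨fun x y => (h.intervalIntegrable x y).add (k.intervalIntegrable x y), fun x y => ?_⟩
  rw [intervalIntegral.integral_add (h.intervalIntegrable x y) (k.intervalIntegrable x y),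
    h.integral_eq, k.integral_eq]
  abel

lemma clm [CompleteSpace E] [CompleteSpace F] (L : E →L[ℝ] F) (h : IsPrimitive f f') :
    IsPrimitive (fun x => L (f x)) (fun x => L (f' x)) := by
  refine ⟨fun x y => ⟨L.integrable_comp (h.intervalIntegrable x y).1,
    L.integrable_comp (h.intervalIntegrable x y).2⟩, fun x y => ?_⟩
  rw [L.intervalIntegral_comp_comm (h.intervalIntegrable x y), h.integral_eq, map_sub]

lemma of_hasDerivAt [CompleteSpace E] (h : ∀ x, HasDerivAt f (f' x) x) (hc : Continuous f') :
    IsPrimitive f f' :=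
  ⟨fun x y => hc.intervalIntegrable x y, fun x y =>
    intervalIntegral.integral_eq_sub_of_hasDerivAt (fun t _ => h t) (hc.intervalIntegrable x y)⟩

end General

section Real

variable {f f' g g' : ℝ → ℝ}

lemma absolutelyContinuousOnInterval (h : IsPrimitive f f') (x y : ℝ) :
    AbsolutelyContinuousOnInterval f x y := by
  rw [h.eq_add_integral x]
  have h1 := (h.intervalIntegrable x y).absolutelyContinuousOnInterval_intervalIntegral
    (c := x) (by simp)
  have h2 : AbsolutelyContinuousOnInterval (fun _ : ℝ => f x) x y :=
    (contDiff_const.contDiffOn (n := 1)).absolutelyContinuousOnInterval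
  exact h2.add h1

lemma locallyIntegrable (h : IsPrimitive f f') : LocallyIntegrable f' := by
  rw [locallyIntegrable_iff]
  intro k hk
  obtain ⟨R, hR⟩ := hk.isBounded.subset_closedBall 0
  rw [Real.closedBall_eq_Icc] at hR
  refine IntegrableOn.mono_set ?_ hR
  by_cases hle : (0 : ℝ) - R ≤ 0 + R
  · exact (intervalIntegrable_iff_integrableOn_Icc_of_le hle).1 (h.intervalIntegrable _ _)
  · rw [Icc_eq_empty hle]; exact integrableOn_empty

lemma ae_hasDerivAt (h : IsPrimitive f f') : ∀ᵐ x, HasDerivAt f (f' x) x := by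
  filter_upwards [_root_.LocallyIntegrable.ae_hasDerivAt_integral h.locallyIntegrable] with x hx
  rw [h.eq_add_integral 0]
  exact (hx 0).const_add _

lemma mul (h : IsPrimitive f f') (k : IsPrimitive g g') :
    IsPrimitive (fun x => f x * g x) (fun x => f' x * g x + f x * g' x) := by
  refine ⟨fun x y => ?_, fun x y => ?_⟩
  · exact ((h.intervalIntegrable x y).mul_continuousOn k.continuous.continuousOn).add
      ((k.intervalIntegrable x y).continuousOn_mul h.continuous.continuousOn)
  · rw [← (h.absolutelyContinuousOnInterval x y).integral_deriv_mul_eq_sub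
      (k.absolutelyContinuousOnInterval x y)]
    apply intervalIntegral.integral_congr_ae
    filter_upwards [h.ae_hasDerivAt, k.ae_hasDerivAt] with t ht kt _
    rw [ht.deriv, kt.deriv]

end Real

section Complex

variable {u v : ℝ → ℂ}

lemma re (h : IsPrimitive u v) : IsPrimitive (fun x => (u x).re) (fun x => (v x).re) :=
  h.clm Complex.reCLM

lemma im (h : IsPrimitive u v) : IsPrimitive (fun x => (u x).im) (fun x => (v x).im) :=
  h.clm Complex.imCLM

lemma ofReal {f f' : ℝ → ℝ} (h : IsPrimitive f f') :
    IsPrimitive (fun x => (f x : ℂ)) (fun x => (f' x : ℂ)) :=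
  h.clm Complex.ofRealCLM

/-- The real product rule `mul` is applied to real and imaginary parts; `h2` is the imaginary part
multiplied by `I`. -/
lemma smul {f f' : ℝ → ℝ} (h : IsPrimitive f f') (k : IsPrimitive u v) :
    IsPrimitive (fun x => f x • u x) (fun x => f' x • u x + f x • v x) := by
  have h1 := (h.mul k.re).ofReal
  have h2 := ((h.mul k.im).ofReal).clm
    ((ContinuousLinearMap.mul ℝ ℂ) Complex.I)
  convert h1.add h2 using 2 with x x
  all_goals apply Complex.ext <;> simp

lemma norm_sq (h : IsPrimitive u v) :
    IsPrimitive (fun x => ‖u x‖ ^ 2) (fun x => 2 * ((u x).re * (v x).re + (u x).im * (v x).im)) := by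
  convert (h.re.mul h.re).add (h.im.mul h.im) using 2 with x x
  · rw [Complex.sq_norm, Complex.normSq_apply]
  · ring

/-- A primitive is weakly differentiable. -/
lemma isWeakDeriv (h : IsPrimitive u v) : IsWeakDeriv u v := by
  intro φ hφ hc
  have hφ' : Continuous (deriv φ) := hφ.continuous_deriv (by simp)
  have hd : ∀ x, HasDerivAt φ (deriv φ x) x := fun x =>
    ((hφ.differentiable (by simp)) x).hasDerivAt
  have hP := (IsPrimitive.of_hasDerivAt hd hφ').smul h
  obtain ⟨R, hR⟩ := hc.isCompact.isBounded.subset_ball 0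
  rw [Real.ball_eq_Ioo, zero_sub, zero_add] at hR
  have hR' : tsupport φ ⊆ Ioc (-R) R := hR.trans Ioo_subset_Ioc_self
  have z1 : φ R = 0 := image_eq_zero_of_notMem_tsupport fun hx => lt_irrefl _ (hR hx).2
  have z2 : φ (-R) = 0 := image_eq_zero_of_notMem_tsupport fun hx => lt_irrefl _ (hR hx).1
  have s1 : Function.support (fun x => deriv φ x • u x) ⊆ Ioc (-R) R :=
    (Function.support_smul_subset_left _ _).trans ((support_deriv_subset).trans hR')
  have s2 : Function.support (fun x => φ x • v x) ⊆ Ioc (-R) R :=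
    (Function.support_smul_subset_left _ _).trans ((subset_tsupport _).trans hR')
  rw [← intervalIntegral.integral_eq_integral_of_support_subset s1,
    ← intervalIntegral.integral_eq_integral_of_support_subset s2, ← add_eq_zero_iff_eq_neg,
    ← intervalIntegral.integral_add, hP.integral_eq, z1, z2]
  · simp
  · exact (hφ'.smul h.continuous).intervalIntegrable _ _
  · exact (h.intervalIntegrable _ _).continuousOn_smul hφ.continuous.continuousOn

end Complex

end IsPrimitive

/-! ### Weak derivatives and continuous representatives -/

/-- The primitive started to the left of the support vanishes again to its right precisely because
the mean is zero. -/
lemma exists_test_function_deriv_eq {ψ : ℝ → ℝ} (hψ : ContDiff ℝ ∞ ψ) (hc : HasCompactSupport ψ)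
    (h0 : ∫ x, ψ x = 0) :
    ∃ φ : ℝ → ℝ, ContDiff ℝ ∞ φ ∧ HasCompactSupport φ ∧ deriv φ = ψ := by
  obtain ⟨R, hR⟩ := hc.isCompact.isBounded.subset_ball 0
  rw [Real.ball_eq_Ioo, zero_sub, zero_add] at hR
  have hd : deriv (fun x => ∫ t in (-R)..x, ψ t) = ψ := by
    ext x; exact hψ.continuous.deriv_integral ψ _ _
  refine ⟨fun x => ∫ t in (-R)..x, ψ t, ?_, ?_, hd⟩
  · rw [contDiff_infty_iff_deriv, hd]
    refine ⟨fun x => ?_, hψ⟩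
    exact (intervalIntegral.integral_hasDerivAt_right (hψ.continuous.intervalIntegrable _ _)
      (hψ.continuous.stronglyMeasurableAtFilter _ _) hψ.continuous.continuousAt).differentiableAt
  · refine HasCompactSupport.intro (isCompact_Icc (a := -R) (b := R)) fun x hx => ?_
    rw [mem_Icc, not_and_or, not_le, not_le] at hx
    rcases hx with hx | hx
    · rw [intervalIntegral.integral_congr (g := fun _ => 0)]
      · simp
      · intro t ht
        rw [uIcc_of_ge hx.le] at ht
        exact image_eq_zero_of_notMem_tsupport fun h => absurd (hR h).1 (not_lt.2 ht.2)
    · rw [intervalIntegral.integral_eq_integral_of_support_subset, h0]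
      exact ((subset_tsupport ψ).trans hR).trans fun t ht => ⟨ht.1, (ht.2.trans hx).le⟩

/-- The lemma of du Bois-Reymond. -/
lemma ae_eq_const_of_integral_deriv_smul_eq_zero {g : ℝ → ℂ} (hg : LocallyIntegrable g)
    (h : ∀ φ : ℝ → ℝ, ContDiff ℝ ∞ φ → HasCompactSupport φ → ∫ x, deriv φ x • g x = 0) :
    ∃ c : ℂ, g =ᵐ[volume] fun _ => c := by
  let η : ContDiffBump (0 : ℝ) := ⟨1, 2, by norm_num, by norm_num⟩
  have hη : ContDiff ℝ ∞ (η.normed volume) := η.contDiff_normed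
  have hηc : HasCompactSupport (η.normed volume) := η.hasCompactSupport_normed
  set c := ∫ x, η.normed volume x • g x with hcdef
  have hint : ∀ ψ : ℝ → ℝ, ContDiff ℝ ∞ ψ → HasCompactSupport ψ →
      Integrable (fun x => ψ x • g x) := fun ψ hψ hc =>
    hg.integrable_smul_left_of_hasCompactSupport hψ.continuous hc
  refine ⟨c, ?_⟩
  have key := ae_eq_zero_of_integral_contDiff_smul_eq_zero
    (f := fun x => g x - c) (μ := volume) (hg.sub (locallyIntegrable_const c)) ?_
  · filter_upwards [key] with x hx using sub_eq_zero.1 hx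
  intro ψ hψ hψc
  have hψi : Integrable ψ := hψ.continuous.integrable_of_hasCompactSupport hψc
  have hηi : Integrable (η.normed volume) := hη.continuous.integrable_of_hasCompactSupport hηc
  -- Subtracting a multiple of the unit-mass bump makes `ψ` mean-free, hence the derivative of a
  -- test function; the hypothesis then reads `∫ ψ g = (∫ ψ) c`.
  obtain ⟨φ, hφ, hφc, hφd⟩ := exists_test_function_deriv_eq
    (ψ := fun x => ψ x - (∫ t, ψ t) * η.normed volume x)
    (hψ.sub (contDiff_const.mul hη)) (hψc.sub hηc.mul_left) (by
      rw [integral_sub hψi (hηi.const_mul _), integral_const_mul, η.integral_normed, mul_one,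
        sub_self])
  have h1 := h φ hφ hφc
  rw [hφd] at h1
  simp only [sub_smul, mul_smul] at h1
  rw [integral_sub (hint ψ hψ hψc) (by exact (hint _ hη hηc).smul _), integral_smul, ← hcdef] at h1
  simp only [smul_sub]
  rw [integral_sub (hint ψ hψ hψc) (hψi.smul_const c), integral_smul_const]
  exact h1

/-- This makes the arbitrary choice in `weakDeriv` harmless: it may be replaced by any known square
integrable weak derivative. -/
lemma IsWeakDeriv.ae_eq {u v w : ℝ → ℂ} (hv : IsWeakDeriv u v) (hw : IsWeakDeriv u w)
    (hvl : LocallyIntegrable v) (hwl : LocallyIntegrable w) : v =ᵐ[volume] w := by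
  have key := ae_eq_zero_of_integral_contDiff_smul_eq_zero
    (f := fun x => v x - w x) (μ := volume) (hvl.sub hwl) ?_
  · filter_upwards [key] with x hx using sub_eq_zero.1 hx
  intro φ hφ hc
  have e := (hv φ hφ hc).symm.trans (hw φ hφ hc)
  simp only [smul_sub]
  rw [integral_sub (hvl.integrable_smul_left_of_hasCompactSupport hφ.continuous hc)
    (hwl.integrable_smul_left_of_hasCompactSupport hφ.continuous hc), neg_injective e, sub_self]

lemma intervalIntegrable_of_locallyIntegrable {v : ℝ → ℂ} (hv : LocallyIntegrable v) (x y : ℝ) :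
    IntervalIntegrable v volume x y :=
  (hv.integrableOn_isCompact isCompact_uIcc).intervalIntegrable

/-- A locally integrable function with locally integrable weak derivative `v` has a representative
that is a primitive of `v`. -/
lemma IsWeakDeriv.exists_isPrimitive {u v : ℝ → ℂ} (h : IsWeakDeriv u v)
    (hul : LocallyIntegrable u) (hvl : LocallyIntegrable v) :
    ∃ w : ℝ → ℂ, w =ᵐ[volume] u ∧ IsPrimitive w v := by
  have hi := intervalIntegrable_of_locallyIntegrable hvl
  have hP := IsPrimitive.of_integral hi 0 (0 : ℂ)
  have hPl : LocallyIntegrable (fun x => (0 : ℂ) + ∫ t in (0 : ℝ)..x, v t) :=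
    hP.continuous.locallyIntegrable
  obtain ⟨c, hc⟩ := ae_eq_const_of_integral_deriv_smul_eq_zero (hul.sub hPl) (by
    intro φ hφ hφc
    have hφ' : Continuous (deriv φ) := hφ.continuous_deriv (by simp)
    simp only [Pi.sub_apply, smul_sub]
    rw [integral_sub (hul.integrable_smul_left_of_hasCompactSupport hφ' hφc.deriv)
      (hPl.integrable_smul_left_of_hasCompactSupport hφ' hφc.deriv), h φ hφ hφc,
      hP.isWeakDeriv φ hφ hφc, sub_self])
  refine ⟨_, ?_, IsPrimitive.of_integral hi 0 c⟩
  filter_upwards [hc] with x hx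
  simp only [Pi.sub_apply, zero_add] at hx
  rw [← hx]; ring

/-! ### Mass-one functions: decay, sup bounds and the energy -/

/-- `u` is an absolutely continuous square integrable function with square integrable
derivative `v`, and `u` has mass one. -/
structure Normalized (u v : ℝ → ℂ) : Prop where
  memLp : MemLp u 2
  memLp_deriv : MemLp v 2
  isPrimitive : IsPrimitive u v
  integral_norm_sq : ∫ x, ‖u x‖ ^ 2 = 1

/-- The kinetic and interaction energy of `u` with derivative `v`. -/
noncomputable def untrappedEnergy (a b : ℝ) (u v : ℝ → ℂ) : ℝ :=
  (∫ x, ‖v x‖ ^ 2) + a / 2 * (∫ x, ‖u x‖ ^ 4) - b / 6 * ∫ x, ‖u x‖ ^ 6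

/-- The energy of `u` in the trapping potential `|x| ^ s`. -/
noncomputable def trapEnergy (s : ℝ) (u : ℝ → ℂ) : ℝ≥0∞ :=
  ∫⁻ x : ℝ, ENNReal.ofReal (|x| ^ s * ‖u x‖ ^ 2)

lemma eLpNorm_two_eq_one_iff {u : ℝ → ℂ} (hu : MemLp u 2) :
    eLpNorm u 2 = 1 ↔ ∫ x, ‖u x‖ ^ 2 = 1 := by
  rw [hu.eLpNorm_eq_integral_rpow_norm (by norm_num) (by norm_num)]
  have h0 : 0 ≤ ∫ x, ‖u x‖ ^ 2 := integral_nonneg fun x => by positivity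
  simp only [ENNReal.toReal_ofNat, Real.rpow_ofNat, ENNReal.ofReal_eq_one]
  constructor
  · intro h
    rw [← Real.rpow_inv_rpow h0 (two_ne_zero (α := ℝ)), h, Real.one_rpow]
  · intro h; rw [h, Real.one_rpow]

namespace Normalized

variable {u v : ℝ → ℂ}

lemma continuous (h : Normalized u v) : Continuous u := h.isPrimitive.continuous

lemma integrable_sq (h : Normalized u v) : Integrable fun x => ‖u x‖ ^ 2 :=
  h.memLp.integrable_norm_pow (p := 2) two_ne_zero

lemma integrable_deriv_sq (h : Normalized u v) : Integrable fun x => ‖v x‖ ^ 2 :=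
  h.memLp_deriv.integrable_norm_pow (p := 2) two_ne_zero

/-- Young's inequality for the derivative of `|u|²`. The weight `t` stays free so that the kinetic
energy can later enter with a small coefficient `1 / t`. -/
lemma norm_deriv_norm_sq_le {t : ℝ} (ht : 0 < t) (z w : ℂ) :
    |2 * (z.re * w.re + z.im * w.im)| ≤ t * ‖z‖ ^ 2 + ‖w‖ ^ 2 / t := by
  rw [Complex.sq_norm, Complex.sq_norm, Complex.normSq_apply, Complex.normSq_apply, abs_le]
  have e : ∀ p q : ℝ, t * (p * p) + (q * q) / t + 2 * (p * q) = t * (p + q / t) ^ 2 := by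
    intro p q; field_simp; ring
  have e' : ∀ p q : ℝ, t * (p * p) + (q * q) / t - 2 * (p * q) = t * (p - q / t) ^ 2 := by
    intro p q; field_simp; ring
  have p1 := e z.re w.re
  have p2 := e z.im w.im
  have p3 := e' z.re w.re
  have p4 := e' z.im w.im
  have q1 : 0 ≤ t * (z.re + w.re / t) ^ 2 := by positivity
  have q2 : 0 ≤ t * (z.im + w.im / t) ^ 2 := by positivity
  have q3 : 0 ≤ t * (z.re - w.re / t) ^ 2 := by positivity
  have q4 : 0 ≤ t * (z.im - w.im / t) ^ 2 := by positivity
  have d := add_div (w.re * w.re) (w.im * w.im) t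
  constructor <;> nlinarith

lemma integrable_deriv_norm_sq (h : Normalized u v) :
    Integrable fun x => 2 * ((u x).re * (v x).re + (u x).im * (v x).im) := by
  refine Integrable.mono' ((h.integrable_sq.const_mul 1).add (h.integrable_deriv_sq.div_const 1))
    ?_ (ae_of_all _ fun x => norm_deriv_norm_sq_le one_pos (u x) (v x))
  have hu := h.memLp.aestronglyMeasurable
  have hv := h.memLp_deriv.aestronglyMeasurable
  exact (((Complex.continuous_re.comp_aestronglyMeasurable hu).mul
    (Complex.continuous_re.comp_aestronglyMeasurable hv)).add
    ((Complex.continuous_im.comp_aestronglyMeasurable hu).mul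
    (Complex.continuous_im.comp_aestronglyMeasurable hv))).const_mul 2

/-- The derivative of `|u|²` is integrable, so `|u|²` has a limit; since `|u|²` is itself
integrable, that limit is zero. -/
lemma tendsto_norm_sq_atTop (h : Normalized u v) :
    Tendsto (fun x => ‖u x‖ ^ 2) atTop (𝓝 0) := by
  have h1 := (intervalIntegral_tendsto_integral_Ioi 0
    h.integrable_deriv_norm_sq.integrableOn tendsto_id).const_add (‖u 0‖ ^ 2)
  simp only [id, h.isPrimitive.norm_sq.integral_eq, add_sub_cancel] at h1
  have h2 := IntegrableAtFilter.eq_zero_of_tendsto (h.integrable_sq.integrableAtFilter _)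
    (fun s hs => by
      obtain ⟨r, hr⟩ := mem_atTop_sets.1 hs
      exact measure_mono_top (show Ici r ⊆ s from hr) (by simp)) h1
  rwa [h2] at h1

lemma tendsto_norm_sq_atBot (h : Normalized u v) :
    Tendsto (fun x => ‖u x‖ ^ 2) atBot (𝓝 0) := by
  have h1 := (intervalIntegral_tendsto_integral_Iic 0
    h.integrable_deriv_norm_sq.integrableOn tendsto_id).const_sub (‖u 0‖ ^ 2)
  simp only [id, h.isPrimitive.norm_sq.integral_eq, sub_sub_cancel] at h1
  have h2 := IntegrableAtFilter.eq_zero_of_tendsto (h.integrable_sq.integrableAtFilter _)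
    (fun s hs => by
      obtain ⟨r, hr⟩ := mem_atBot_sets.1 hs
      exact measure_mono_top (show Iic r ⊆ s from hr) (by simp)) h1
  rwa [h2] at h1

/-- The supremum of `‖u‖ ^ 2` is controlled by the `H¹` norm. -/
lemma norm_sq_le (h : Normalized u v) {t : ℝ} (ht : 0 < t) (x : ℝ) :
    ‖u x‖ ^ 2 ≤ t + (∫ x, ‖v x‖ ^ 2) / t := by
  have hb := (h.integrable_sq.const_mul t).add (h.integrable_deriv_sq.div_const t)
  have h1 : ∀ y ≤ x, ‖u x‖ ^ 2 - ‖u y‖ ^ 2 ≤ t + (∫ x, ‖v x‖ ^ 2) / t := by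
    intro y hy
    rw [← h.isPrimitive.norm_sq.integral_eq y x]
    calc _ ≤ ∫ r in y..x, (t * ‖u r‖ ^ 2 + ‖v r‖ ^ 2 / t) :=
          intervalIntegral.integral_mono_on hy h.integrable_deriv_norm_sq.intervalIntegrable
            hb.intervalIntegrable
            fun r _ => (le_abs_self _).trans (norm_deriv_norm_sq_le ht (u r) (v r))
      _ ≤ ∫ r, (t * ‖u r‖ ^ 2 + ‖v r‖ ^ 2 / t) := by
          rw [intervalIntegral.integral_of_le hy]
          exact setIntegral_le_integral hb (ae_of_all _ fun r => by
            show 0 ≤ t * ‖u r‖ ^ 2 + ‖v r‖ ^ 2 / t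
            positivity)
      _ = _ := by
          rw [integral_add (h.integrable_sq.const_mul t) (h.integrable_deriv_sq.div_const t),
            integral_const_mul, integral_div, h.integral_norm_sq, mul_one]
  have h2 : Tendsto (fun y => ‖u x‖ ^ 2 - ‖u y‖ ^ 2) atBot (𝓝 (‖u x‖ ^ 2 - 0)) :=
    h.tendsto_norm_sq_atBot.const_sub _
  rw [sub_zero] at h2
  exact le_of_tendsto h2 ((eventually_le_atBot x).mono h1)

lemma integrable_pow (h : Normalized u v) (n : ℕ) : Integrable fun x => ‖u x‖ ^ (2 * n + 2) := by
  have hc := h.continuous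
  refine Integrable.mono' (h.integrable_sq.const_mul ((1 + (∫ x, ‖v x‖ ^ 2) / 1) ^ n))
    (by fun_prop) (ae_of_all _ fun x => ?_)
  rw [Real.norm_of_nonneg (by positivity), pow_add, pow_mul]
  gcongr
  exact h.norm_sq_le one_pos x

lemma integrable_pow_four (h : Normalized u v) : Integrable fun x => ‖u x‖ ^ 4 :=
  h.integrable_pow 1

lemma integrable_pow_six (h : Normalized u v) : Integrable fun x => ‖u x‖ ^ 6 :=
  h.integrable_pow 2

lemma admissible (h : Normalized u v) : Admissible u :=
  ⟨⟨h.memLp, v, h.memLp_deriv, h.isPrimitive.isWeakDeriv⟩,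
    (eLpNorm_two_eq_one_iff h.memLp).2 h.integral_norm_sq⟩

lemma energy_eq (h : Normalized u v) (s a b : ℝ) :
    energy s a b u = (untrappedEnergy a b u v : EReal) + (trapEnergy s u : EReal) := by
  have hex : ∃ v : ℝ → ℂ, MemLp v 2 volume ∧ IsWeakDeriv u v :=
    ⟨v, h.memLp_deriv, h.isPrimitive.isWeakDeriv⟩
  have hv : weakDeriv u =ᵐ[volume] v := by
    rw [weakDeriv, dif_pos hex]
    exact hex.choose_spec.2.ae_eq h.isPrimitive.isWeakDeriv
      (hex.choose_spec.1.locallyIntegrable (by norm_num))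
      (h.memLp_deriv.locallyIntegrable (by norm_num))
  rw [energy, trapEnergy, untrappedEnergy, ← integral_const_mul, ← integral_const_mul,
    ← integral_add h.integrable_deriv_sq (h.integrable_pow_four.const_mul _),
    ← integral_sub (by exact h.integrable_deriv_sq.add (h.integrable_pow_four.const_mul _))
      (h.integrable_pow_six.const_mul _)]
  congr 2
  apply integral_congr_ae
  filter_upwards [hv] with x hx
  simp only [hx]

end Normalized

lemma energy_congr_ae {u w : ℝ → ℂ} (h : w =ᵐ[volume] u) (s a b : ℝ) :
    energy s a b w = energy s a b u := by
  -- Test integrals ignore null sets, so the two predicates are equal, and `choose` then returns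
  -- literally the same function.
  have hd : weakDeriv w = weakDeriv u := by
    have : IsWeakDeriv w = IsWeakDeriv u := by
      ext v
      refine forall_congr' fun φ => forall_congr' fun _ => forall_congr' fun _ => ?_
      rw [integral_congr_ae (g := fun x => deriv φ x • u x)]
      filter_upwards [h] with x hx using by simp only [hx]
    unfold weakDeriv
    generalize IsWeakDeriv w = P at this ⊢
    subst this
    rfl
  rw [energy, energy, hd]
  refine congrArg₂ _ (congrArg _ ?_) ?_
  · exact integral_congr_ae (by filter_upwards [h] with x hx using by simp only [hx])
  · refine congrArg _ ?_
    exact lintegral_congr_ae (by filter_upwards [h] with x hx using by simp only [hx])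

lemma Admissible.exists_normalized {u : ℝ → ℂ} (h : Admissible u) :
    ∃ w v : ℝ → ℂ, w =ᵐ[volume] u ∧ Normalized w v := by
  obtain ⟨⟨hu, v, hv, hd⟩, h1⟩ := h
  obtain ⟨w, hw, hP⟩ := hd.exists_isPrimitive (hu.locallyIntegrable (by norm_num))
    (hv.locallyIntegrable (by norm_num))
  have hwl : MemLp w 2 := (memLp_congr_ae hw).2 hu
  exact ⟨w, v, hw, hwl, hv, hP,
    (eLpNorm_two_eq_one_iff hwl).1 ((eLpNorm_congr_ae hw).trans h1)⟩

/-! ### The sharp Gagliardo-Nirenberg inequality -/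

namespace Normalized

variable {u v : ℝ → ℂ}

/-- The fraction of the mass of `u` to the left of `x`. -/
noncomputable def cumulativeMass (u : ℝ → ℂ) (x : ℝ) : ℝ := ∫ t in Iic x, ‖u t‖ ^ 2

lemma cumulativeMass_nonneg (u : ℝ → ℂ) (x : ℝ) : 0 ≤ cumulativeMass u x :=
  integral_nonneg fun _ => by positivity

lemma cumulativeMass_le_one (h : Normalized u v) (x : ℝ) : cumulativeMass u x ≤ 1 := by
  rw [← h.integral_norm_sq]
  exact setIntegral_le_integral h.integrable_sq (ae_of_all _ fun _ => by positivity)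

lemma hasDerivAt_cumulativeMass (h : Normalized u v) (x : ℝ) :
    HasDerivAt (cumulativeMass u) (‖u x‖ ^ 2) x := by
  have e : cumulativeMass u = fun y => cumulativeMass u 0 + ∫ t in (0 : ℝ)..y, ‖u t‖ ^ 2 := by
    ext y
    rw [← intervalIntegral.integral_Iic_sub_Iic h.integrable_sq.integrableOn
      h.integrable_sq.integrableOn, cumulativeMass, cumulativeMass]
    ring
  have hc : Continuous fun t => ‖u t‖ ^ 2 := h.continuous.norm.pow 2
  rw [e]
  exact (intervalIntegral.integral_hasDerivAt_right (hc.intervalIntegrable _ _)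
    (hc.stronglyMeasurableAtFilter _ _) hc.continuousAt).const_add _

/-- A calibration argument: with `G = -κ tan θ |u|⁴`, the pointwise bound `κ² |u|⁶ + G'/2 ≤ |u'|²`
holds. Strict inequality `κ < π/2` keeps `tan θ` bounded, so `G` vanishes at both ends and
integrating gives the claim. -/
lemma mul_integral_pow_six_le_of_lt (h : Normalized u v) {κ : ℝ} (h0 : 0 < κ)
    (h1 : κ < Real.pi / 2) : κ ^ 2 * ∫ x, ‖u x‖ ^ 6 ≤ ∫ x, ‖v x‖ ^ 2 := by
  set θ : ℝ → ℝ := fun x => κ * (2 * cumulativeMass u x - 1) with hθ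
  have hθa : ∀ x, |θ x| ≤ κ := by
    intro x
    have a1 := cumulativeMass_nonneg u x
    have a2 := h.cumulativeMass_le_one x
    rw [hθ, abs_le]
    constructor <;> nlinarith
  have hcosκ : 0 < Real.cos κ :=
    Real.cos_pos_of_mem_Ioo ⟨by linarith, h1⟩
  have hcos : ∀ x, Real.cos κ ≤ Real.cos (θ x) := by
    intro x
    rw [← Real.cos_abs (θ x)]
    exact Real.cos_le_cos_of_nonneg_of_le_pi (abs_nonneg _) (by linarith [Real.pi_pos]) (hθa x)
  have hcosp : ∀ x, 0 < Real.cos (θ x) := fun x => hcosκ.trans_le (hcos x)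
  have hθd : ∀ x, HasDerivAt θ (κ * (2 * ‖u x‖ ^ 2)) x := fun x =>
    (((h.hasDerivAt_cumulativeMass x).const_mul 2).sub_const 1).const_mul κ
  have hθc : Continuous θ := continuous_iff_continuousAt.2 fun x => (hθd x).continuousAt
  have hc := h.continuous
  have hg : IsPrimitive (fun x => -κ * Real.tan (θ x))
      (fun x => -κ * (1 / Real.cos (θ x) ^ 2 * (κ * (2 * ‖u x‖ ^ 2)))) := by
    refine IsPrimitive.of_hasDerivAt (fun x =>
      ((Real.hasDerivAt_tan (hcosp x).ne').comp x (hθd x)).const_mul (-κ)) ?_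
    refine continuous_const.mul (Continuous.mul (Continuous.div continuous_const ?_ ?_) ?_)
    · exact (Real.continuous_cos.comp hθc).pow 2
    · exact fun x => (pow_pos (hcosp x) 2).ne'
    · fun_prop
  have hG := (h.isPrimitive.norm_sq.mul h.isPrimitive.norm_sq).mul hg
  set G := fun x => ‖u x‖ ^ 2 * ‖u x‖ ^ 2 * (-κ * Real.tan (θ x)) with hGdef
  have hGb : ∀ x, ‖G x‖ ≤ ‖u x‖ ^ 2 * ‖u x‖ ^ 2 * (κ * (1 / Real.cos κ)) := by
    intro x
    rw [hGdef, norm_mul, Real.norm_of_nonneg (by positivity : 0 ≤ ‖u x‖ ^ 2 * ‖u x‖ ^ 2), norm_mul,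
      norm_neg, Real.norm_of_nonneg h0.le, Real.tan_eq_sin_div_cos,
      norm_div, Real.norm_of_nonneg (hcosp x).le]
    gcongr
    · exact Real.abs_sin_le_one _
    · exact hcos x
  have lim : ∀ l : Filter ℝ, Tendsto (fun x => ‖u x‖ ^ 2) l (𝓝 0) → Tendsto G l (𝓝 0) := by
    intro l hl
    refine squeeze_zero_norm hGb ?_
    simpa using (hl.mul hl).mul_const (κ * (1 / Real.cos κ))
  have hkey : ∀ R : ℝ, 0 ≤ R →
      κ ^ 2 * (∫ x in (-R)..R, ‖u x‖ ^ 6) + (1 / 2) * (G R - G (-R)) ≤ ∫ x, ‖v x‖ ^ 2 := by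
    intro R hR
    have i1 : IntervalIntegrable (fun x => κ ^ 2 * ‖u x‖ ^ 6) volume (-R) R :=
      (h.integrable_pow_six.const_mul _).intervalIntegrable
    have i2 := (hG.intervalIntegrable (-R) R).const_mul (1 / 2)
    rw [← intervalIntegral.integral_const_mul, ← hG.integral_eq,
      ← intervalIntegral.integral_const_mul, ← intervalIntegral.integral_add i1 i2]
    calc _ ≤ ∫ x in (-R)..R, ‖v x‖ ^ 2 := by
          refine intervalIntegral.integral_mono_on (by linarith) (i1.add i2)
            h.integrable_deriv_sq.intervalIntegrable fun x _ => ?_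
          have hsec : 1 / Real.cos (θ x) ^ 2 = 1 + Real.tan (θ x) ^ 2 := by
            rw [Real.tan_eq_sin_div_cos]
            have := (hcosp x).ne'
            field_simp
            linarith [Real.sin_sq_add_cos_sq (θ x)]
          have e6 : ‖u x‖ ^ 6 = (‖u x‖ ^ 2) ^ 3 := by ring
          rw [hsec, e6]
          generalize Real.tan (θ x) = T
          rw [Complex.sq_norm, Complex.sq_norm, Complex.normSq_apply, Complex.normSq_apply]
          generalize (u x).re = p
          generalize (u x).im = q
          generalize (v x).re = r
          generalize (v x).im = w
          -- The two squares add up to `|u' + κ T |u|² u|²`; the `1` in `sec² = 1 + T²` is what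
          -- cancels `κ² |u|⁶`.
          nlinarith [sq_nonneg (r + κ * T * (p * p + q * q) * p),
            sq_nonneg (w + κ * T * (p * p + q * q) * q)]
      _ ≤ _ := by
          rw [intervalIntegral.integral_of_le (by linarith)]
          exact setIntegral_le_integral h.integrable_deriv_sq (ae_of_all _ fun _ => by positivity)
  have t1 := (intervalIntegral_tendsto_integral h.integrable_pow_six tendsto_neg_atTop_atBot
    tendsto_id).const_mul (κ ^ 2)
  have t2 := ((lim _ h.tendsto_norm_sq_atTop).sub
    ((lim _ h.tendsto_norm_sq_atBot).comp tendsto_neg_atTop_atBot)).const_mul (1 / 2)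
  have t3 := t1.add t2
  rw [sub_zero, mul_zero, add_zero] at t3
  exact le_of_tendsto t3 ((eventually_ge_atTop 0).mono hkey)

/-- The sharp Gagliardo-Nirenberg inequality for the sixth power. -/
theorem gagliardo_nirenberg (h : Normalized u v) :
    criticalMass / 6 * ∫ x, ‖u x‖ ^ 6 ≤ ∫ x, ‖v x‖ ^ 2 := by
  have e : criticalMass / 6 = (Real.pi / 2) ^ 2 := by rw [criticalMass]; ring
  have hlim : Tendsto (fun κ : ℝ => κ ^ 2 * ∫ x, ‖u x‖ ^ 6) (𝓝[<] (Real.pi / 2))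
      (𝓝 ((Real.pi / 2) ^ 2 * ∫ x, ‖u x‖ ^ 6)) :=
    tendsto_nhdsWithin_of_tendsto_nhds (Continuous.tendsto (by fun_prop) _)
  rw [e]
  refine le_of_tendsto hlim ?_
  filter_upwards [Ioo_mem_nhdsLT (show (0 : ℝ) < Real.pi / 2 by positivity)] with κ hκ
  exact h.mul_integral_pow_six_le_of_lt hκ.1 hκ.2

end Normalized

/-! ### The optimizer and its energy at scale `1 / τ` -/

/-- The mass density of the optimizer of the sharp Gagliardo-Nirenberg inequality. -/
noncomputable def solitonDensity (x : ℝ) : ℝ := 1 / Real.cosh (Real.pi * x)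

lemma solitonDensity_pos (x : ℝ) : 0 < solitonDensity x := one_div_pos.2 (Real.cosh_pos _)

lemma solitonDensity_le_one (x : ℝ) : solitonDensity x ≤ 1 := by
  rw [solitonDensity, div_le_one (Real.cosh_pos _)]
  exact Real.one_le_cosh _

lemma continuous_solitonDensity : Continuous solitonDensity :=
  continuous_const.div (by fun_prop) fun _ => (Real.cosh_pos _).ne'

lemma solitonDensity_neg (x : ℝ) : solitonDensity (-x) = solitonDensity x := by
  rw [solitonDensity, mul_neg, Real.cosh_neg, solitonDensity]

lemma solitonDensity_le (x : ℝ) : solitonDensity x ≤ 2 * Real.exp (-Real.pi * x) := by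
  rw [solitonDensity, div_le_iff₀ (Real.cosh_pos _), Real.cosh_eq]
  have e : Real.exp (-Real.pi * x) * Real.exp (Real.pi * x) = 1 := by
    rw [← Real.exp_add]; simp
  have p : 0 ≤ Real.exp (-Real.pi * x) * Real.exp (-(Real.pi * x)) := by positivity
  nlinarith

lemma integrable_of_even {f : ℝ → ℝ} (he : ∀ x, f (-x) = f x) (h : IntegrableOn f (Ioi 0)) :
    Integrable f := by
  have h' : IntegrableOn f (Iio 0) := by
    have := ((Measure.measurePreserving_neg (volume : Measure ℝ)).integrableOn_comp_preimage
      (Homeomorph.neg ℝ).measurableEmbedding).2 h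
    simpa [Function.comp_def, he] using this
  rw [← integrableOn_univ, ← Iic_union_Ioi (a := (0 : ℝ)), integrableOn_union]
  exact ⟨(integrableOn_Iic_iff_integrableOn_Iio (by simp)).2 h', h⟩

lemma integrable_rpow_mul_solitonDensity {s : ℝ} (hs : 0 ≤ s) :
    Integrable fun x : ℝ => |x| ^ s * solitonDensity x := by
  have hc := continuous_solitonDensity
  refine integrable_of_even (fun x => by rw [abs_neg, solitonDensity_neg]) ?_
  have h := (integrableOn_rpow_mul_exp_neg_mul_rpow (s := s) (p := 1) (by linarith) one_pos
    Real.pi_pos).const_mul 2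
  refine Integrable.mono' h ?_ ?_
  · exact ((continuous_abs.rpow_const fun _ => Or.inr hs).mul hc).aestronglyMeasurable
  · refine (ae_restrict_iff' measurableSet_Ioi).2 (ae_of_all _ fun x hx => ?_)
    have hx0 : 0 ≤ x := le_of_lt hx
    have hp := (solitonDensity_pos x).le
    rw [Real.rpow_one, abs_of_nonneg hx0, Real.norm_of_nonneg (by positivity)]
    calc _ ≤ x ^ s * (2 * Real.exp (-Real.pi * x)) := by gcongr; exact solitonDensity_le x
      _ = _ := by ring

lemma integrable_solitonDensity_pow (n : ℕ) : Integrable fun x => solitonDensity x ^ (n + 1) := by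
  have h := integrable_rpow_mul_solitonDensity le_rfl
  simp only [Real.rpow_zero, one_mul] at h
  refine h.mono' (continuous_solitonDensity.pow _).aestronglyMeasurable (ae_of_all _ fun x => ?_)
  have hp := (solitonDensity_pos x).le
  rw [Real.norm_of_nonneg (by positivity)]
  exact pow_le_of_le_one hp (solitonDensity_le_one x) (by simp)

lemma integrable_solitonDensity : Integrable solitonDensity := by
  simpa using integrable_solitonDensity_pow 0

lemma integral_solitonDensity : ∫ x, solitonDensity x = 1 := by
  have hd : ∀ x, HasDerivAt (fun x => Real.arctan (Real.sinh (Real.pi * x)) / Real.pi)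
      (solitonDensity x) x := by
    intro x
    have h1 : HasDerivAt (fun x => Real.pi * x) Real.pi x := by
      simpa using (hasDerivAt_id x).const_mul Real.pi
    refine (h1.sinh.arctan.div_const Real.pi).congr_deriv ?_
    rw [solitonDensity, add_comm 1, ← Real.cosh_sq]
    have := (Real.cosh_pos (Real.pi * x)).ne'
    have := Real.pi_ne_zero
    field_simp
  have ht : Tendsto (fun x => Real.sinh (Real.pi * x)) atTop atTop :=
    Real.sinhOrderIso.tendsto_atTop.comp (tendsto_id.const_mul_atTop Real.pi_pos)
  have hb : Tendsto (fun x => Real.sinh (Real.pi * x)) atBot atBot :=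
    Real.sinhOrderIso.tendsto_atBot.comp (tendsto_id.const_mul_atBot Real.pi_pos)
  rw [integral_of_hasDerivAt_of_tendsto hd integrable_solitonDensity
    (((tendsto_nhds_of_tendsto_nhdsWithin Real.tendsto_arctan_atBot).comp hb).div_const _)
    (((tendsto_nhds_of_tendsto_nhdsWithin Real.tendsto_arctan_atTop).comp ht).div_const _)]
  have := Real.pi_ne_zero
  field_simp
  ring

lemma tendsto_solitonDensity_atTop : Tendsto solitonDensity atTop (𝓝 0) := by
  refine squeeze_zero (fun x => (solitonDensity_pos x).le) solitonDensity_le ?_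
  have h : Tendsto (fun x : ℝ => -Real.pi * x) atTop atBot :=
    tendsto_id.const_mul_atTop_of_neg (neg_lt_zero.2 Real.pi_pos)
  simpa using (Real.tendsto_exp_atBot.comp h).const_mul 2

lemma tendsto_solitonDensity_atBot : Tendsto solitonDensity atBot (𝓝 0) := by
  refine (tendsto_solitonDensity_atTop.comp tendsto_neg_atBot_atTop).congr fun x => ?_
  exact solitonDensity_neg x

/-- With `ρ` the density, `2ρ³ - ρ` is the derivative of a function vanishing at both ends, so `2 ∫
ρ³ = ∫ ρ = 1`. -/
lemma integral_solitonDensity_pow_three : ∫ x, solitonDensity x ^ 3 = 1 / 2 := by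
  have hd : ∀ x, HasDerivAt
      (fun x => Real.sinh (Real.pi * x) / Real.cosh (Real.pi * x) ^ 2 / Real.pi)
      (2 * solitonDensity x ^ 3 - solitonDensity x) x := by
    intro x
    have h1 : HasDerivAt (fun x => Real.pi * x) Real.pi x := by
      simpa using (hasDerivAt_id x).const_mul Real.pi
    have hc := (Real.cosh_pos (Real.pi * x)).ne'
    refine ((h1.sinh.div (h1.cosh.pow 2) (pow_ne_zero 2 hc)).div_const Real.pi).congr_deriv ?_
    rw [solitonDensity, Pi.pow_apply]
    have := Real.pi_ne_zero
    field_simp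
    linear_combination 2 * Real.cosh (Real.pi * x) * Real.cosh_sq (Real.pi * x)
  have i3 : Integrable fun x => 2 * solitonDensity x ^ 3 :=
    (integrable_solitonDensity_pow 2).const_mul 2
  have hbound : ∀ x, ‖Real.sinh (Real.pi * x) / Real.cosh (Real.pi * x) ^ 2 / Real.pi‖ ≤
      solitonDensity x / Real.pi := by
    intro x
    have hc := Real.cosh_pos (Real.pi * x)
    have hs : |Real.sinh (Real.pi * x)| ≤ Real.cosh (Real.pi * x) :=
      abs_le_of_sq_le_sq (by rw [Real.cosh_sq]; linarith) hc.le
    rw [norm_div, norm_div, Real.norm_of_nonneg Real.pi_pos.le, norm_pow,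
      Real.norm_of_nonneg hc.le, Real.norm_eq_abs, solitonDensity]
    have := Real.pi_pos
    refine div_le_div_of_nonneg_right ?_ this.le
    rw [div_le_div_iff₀ (by positivity) hc]
    nlinarith
  have lim : ∀ l : Filter ℝ, Tendsto solitonDensity l (𝓝 0) → Tendsto
      (fun x => Real.sinh (Real.pi * x) / Real.cosh (Real.pi * x) ^ 2 / Real.pi) l (𝓝 0) := by
    intro l hl
    refine squeeze_zero_norm hbound ?_
    simpa using hl.div_const Real.pi
  have h := integral_of_hasDerivAt_of_tendsto hd (i3.sub integrable_solitonDensity)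
    (lim _ tendsto_solitonDensity_atBot) (lim _ tendsto_solitonDensity_atTop)
  rw [integral_sub i3 integrable_solitonDensity, integral_const_mul, integral_solitonDensity] at h
  linarith

lemma integral_solitonDensity_sq_pos : 0 < ∫ x, solitonDensity x ^ 2 := by
  rw [integral_pos_iff_support_of_nonneg (fun x => sq_nonneg _)
    (integrable_solitonDensity_pow 1)]
  have : Function.support (fun x => solitonDensity x ^ 2) = univ :=
    eq_univ_of_forall fun x => (pow_pos (solitonDensity_pos x) 2).ne'
  rw [this]; simp

/-- The optimizer of the sharp Gagliardo-Nirenberg inequality, concentrated at scale `1 / τ`. -/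
noncomputable def soliton (τ x : ℝ) : ℂ := (√(τ * solitonDensity (τ * x)) : ℝ)

/-- The derivative of `soliton τ`. -/
noncomputable def solitonDeriv (τ x : ℝ) : ℂ :=
  (-(τ * Real.pi / 2) * Real.sinh (Real.pi * (τ * x)) / Real.cosh (Real.pi * (τ * x)) *
    √(τ * solitonDensity (τ * x)) : ℝ)

lemma norm_soliton_sq {τ : ℝ} (hτ : 0 < τ) (x : ℝ) :
    ‖soliton τ x‖ ^ 2 = τ * solitonDensity (τ * x) := by
  rw [soliton, Complex.norm_real, Real.norm_eq_abs, sq_abs,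
    Real.sq_sqrt (mul_nonneg hτ.le (solitonDensity_pos _).le)]

lemma norm_solitonDeriv_sq {τ : ℝ} (hτ : 0 < τ) (x : ℝ) :
    ‖solitonDeriv τ x‖ ^ 2 = τ ^ 3 * (Real.pi ^ 2 / 4) *
      (solitonDensity (τ * x) - solitonDensity (τ * x) ^ 3) := by
  rw [solitonDeriv, Complex.norm_real, Real.norm_eq_abs, sq_abs, mul_pow,
    Real.sq_sqrt (mul_nonneg hτ.le (solitonDensity_pos _).le), solitonDensity]
  have := (Real.cosh_pos (Real.pi * (τ * x))).ne'
  field_simp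
  rw [Real.sinh_sq]
  ring

lemma hasDerivAt_soliton {τ : ℝ} (hτ : 0 < τ) (x : ℝ) :
    HasDerivAt (soliton τ) (solitonDeriv τ x) x := by
  have h1 : HasDerivAt (fun x => Real.pi * (τ * x)) (Real.pi * τ) x := by
    simpa using ((hasDerivAt_id x).const_mul τ).const_mul Real.pi
  have hc := (Real.cosh_pos (Real.pi * (τ * x))).ne'
  have hp : 0 < τ * solitonDensity (τ * x) := mul_pos hτ (solitonDensity_pos _)
  have h2 : HasDerivAt (fun x => τ * solitonDensity (τ * x)) _ x :=
    (((hasDerivAt_const x (1 : ℝ)).div h1.cosh hc).const_mul τ)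
  have h3 := (h2.sqrt hp.ne').ofReal_comp
  refine h3.congr_deriv ?_
  rw [solitonDeriv]
  congr 1
  have hs := (Real.sqrt_pos.2 hp).ne'
  have hq := Real.sq_sqrt hp.le
  rw [div_eq_iff (by positivity)]
  have e : ∀ A : ℝ, A * √(τ * solitonDensity (τ * x)) * (2 * √(τ * solitonDensity (τ * x))) =
      2 * A * (τ * solitonDensity (τ * x)) := by
    intro A; rw [← hq]; ring_nf
    simp
  rw [e, solitonDensity]
  field_simp
  ring

lemma integral_comp_scale (f : ℝ → ℝ) {τ : ℝ} (hτ : 0 < τ) :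
    ∫ x, f (τ * x) = (∫ x, f x) / τ := by
  rw [Measure.integral_comp_mul_left, abs_of_pos (inv_pos.2 hτ), smul_eq_mul]
  ring

lemma integral_norm_soliton_pow {τ : ℝ} (hτ : 0 < τ) (n : ℕ) :
    ∫ x, ‖soliton τ x‖ ^ (2 * (n + 1)) = τ ^ n * ∫ x, solitonDensity x ^ (n + 1) := by
  simp only [pow_mul, norm_soliton_sq hτ, mul_pow]
  rw [integral_const_mul, integral_comp_scale (fun y => solitonDensity y ^ (n + 1)) hτ]
  field_simp
  ring

lemma continuous_solitonDeriv (τ : ℝ) : Continuous (solitonDeriv τ) := by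
  have hc := continuous_solitonDensity
  refine Complex.continuous_ofReal.comp (Continuous.mul (Continuous.div (by fun_prop)
    (by fun_prop) fun x => (Real.cosh_pos _).ne') (by fun_prop))

lemma integral_norm_solitonDeriv_sq {τ : ℝ} (hτ : 0 < τ) :
    ∫ x, ‖solitonDeriv τ x‖ ^ 2 = τ ^ 2 * (Real.pi ^ 2 / 8) := by
  simp only [norm_solitonDeriv_sq hτ]
  rw [integral_const_mul,
    integral_comp_scale (fun y => solitonDensity y - solitonDensity y ^ 3) hτ,
    integral_sub integrable_solitonDensity (integrable_solitonDensity_pow 2),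
    integral_solitonDensity, integral_solitonDensity_pow_three]
  field_simp
  norm_num

lemma normalized_soliton {τ : ℝ} (hτ : 0 < τ) : Normalized (soliton τ) (solitonDeriv τ) := by
  have hP : IsPrimitive (soliton τ) (solitonDeriv τ) :=
    IsPrimitive.of_hasDerivAt (hasDerivAt_soliton hτ) (continuous_solitonDeriv τ)
  refine ⟨?_, ?_, hP, ?_⟩
  · rw [memLp_two_iff_integrable_sq_norm hP.continuous.aestronglyMeasurable]
    simp only [norm_soliton_sq hτ]
    exact (integrable_solitonDensity.comp_mul_left' hτ.ne').const_mul τ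
  · rw [memLp_two_iff_integrable_sq_norm (continuous_solitonDeriv τ).aestronglyMeasurable]
    simp only [norm_solitonDeriv_sq hτ]
    exact ((integrable_solitonDensity.sub (integrable_solitonDensity_pow 2)).comp_mul_left'
      hτ.ne').const_mul _
  · have := integral_norm_soliton_pow hτ 0
    simpa [integral_solitonDensity] using this

/-- Kinetic and sextic terms both scale like `τ²` and cancel exactly at `b = 𝔟`, which shows that
the constant is sharp; the quartic term scales like `τ` and then decides the sign. -/
lemma untrappedEnergy_soliton (a b : ℝ) {τ : ℝ} (hτ : 0 < τ) :
    untrappedEnergy a b (soliton τ) (solitonDeriv τ) =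
      (criticalMass - b) / 12 * τ ^ 2 + a / 2 * (∫ x, solitonDensity x ^ 2) * τ := by
  have h4 := integral_norm_soliton_pow hτ 1
  have h6 := integral_norm_soliton_pow hτ 2
  norm_num at h4 h6
  rw [untrappedEnergy, integral_norm_solitonDeriv_sq hτ, h4, h6, integral_solitonDensity_pow_three,
    criticalMass]
  ring

lemma trapEnergy_soliton {s : ℝ} (hs : 0 < s) {τ : ℝ} (hτ : 0 < τ) :
    trapEnergy s (soliton τ) =
      ENNReal.ofReal (τ ^ (-s) * ∫ x : ℝ, |x| ^ s * solitonDensity x) := by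
  have hi := integrable_rpow_mul_solitonDensity hs.le
  have e : ∀ x : ℝ, |x| ^ s * ‖soliton τ x‖ ^ 2 =
      τ ^ (1 - s) * (|τ * x| ^ s * solitonDensity (τ * x)) := by
    intro x
    rw [norm_soliton_sq hτ, abs_mul, abs_of_pos hτ, Real.mul_rpow hτ.le (abs_nonneg x),
      Real.rpow_sub hτ, Real.rpow_one]
    have := (Real.rpow_pos_of_pos hτ s).ne'
    field_simp
  have hn : ∀ x : ℝ, 0 ≤ τ ^ (1 - s) * (|τ * x| ^ s * solitonDensity (τ * x)) := fun x => by
    have := (solitonDensity_pos (τ * x)).le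
    positivity
  simp only [trapEnergy, e]
  rw [← ofReal_integral_eq_lintegral_ofReal ((hi.comp_mul_left' hτ.ne').const_mul _)
    (ae_of_all _ hn), integral_const_mul,
    integral_comp_scale (fun y => |y| ^ s * solitonDensity y) hτ, Real.rpow_sub hτ, Real.rpow_one,
    Real.rpow_neg hτ.le]
  congr 1
  field_simp

lemma energy_soliton {s : ℝ} (hs : 0 < s) (a b : ℝ) {τ : ℝ} (hτ : 0 < τ) :
    energy s a b (soliton τ) = (((criticalMass - b) / 12 * τ ^ 2 +
      a / 2 * (∫ x, solitonDensity x ^ 2) * τ +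
      τ ^ (-s) * ∫ x : ℝ, |x| ^ s * solitonDensity x : ℝ) : EReal) := by
  have h0 : 0 ≤ τ ^ (-s) * ∫ x : ℝ, |x| ^ s * solitonDensity x :=
    mul_nonneg (by positivity)
      (integral_nonneg fun x => mul_nonneg (by positivity) (solitonDensity_pos x).le)
  rw [(normalized_soliton hτ).energy_eq, untrappedEnergy_soliton a b hτ,
    trapEnergy_soliton hs hτ, EReal.coe_ennreal_ofReal, max_eq_left h0, ← EReal.coe_add]

/-! ### Compactness under kinetic and trapping bounds -/

/-- Sequential weak compactness of balls in a separable Hilbert space. -/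
lemma exists_weakly_convergent_subseq {H : Type*} [NormedAddCommGroup H] [InnerProductSpace ℂ H]
    [CompleteSpace H] [TopologicalSpace.SeparableSpace H] {f : ℕ → H} {r : ℝ}
    (hf : ∀ n, ‖f n‖ ≤ r) :
    ∃ (g : H) (φ : ℕ → ℕ), StrictMono φ ∧
      ∀ h : H, Tendsto (fun n => inner ℂ (f (φ n)) h) atTop (𝓝 (inner ℂ g h)) := by
  obtain ⟨ψ, -, φ, hφ, hlim⟩ := WeakDual.isSeqCompact_closedBall ℂ H 0 r
    (x := fun n => StrongDual.toWeakDual (InnerProductSpace.toDual ℂ H (f n))) (fun n => by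
      rw [mem_preimage, mem_closedBall_zero_iff]
      exact ((InnerProductSpace.toDual ℂ H).norm_map (f n)).trans_le (hf n))
  refine ⟨(InnerProductSpace.toDual ℂ H).symm (WeakDual.toStrongDual ψ), φ, hφ, fun h => ?_⟩
  have := ((WeakDual.eval_continuous (𝕜 := ℂ) h).tendsto ψ).comp hlim
  rw [InnerProductSpace.toDual_symm_apply]
  exact this

/-- Test the weak convergence against `g` itself and use Cauchy-Schwarz. -/
lemma norm_le_of_weak_limit {H : Type*} [NormedAddCommGroup H] [InnerProductSpace ℂ H]
    {f : ℕ → H} {g : H} {A : ℝ}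
    (hw : ∀ h : H, Tendsto (fun n => inner ℂ (f n) h) atTop (𝓝 (inner ℂ g h)))
    (hA : Tendsto (fun n => ‖f n‖ ^ 2) atTop (𝓝 A)) : ‖g‖ ^ 2 ≤ A := by
  have hn : Tendsto (fun n => ‖f n‖) atTop (𝓝 √A) := by
    simpa [Real.sqrt_sq (norm_nonneg _)] using hA.sqrt
  have h1 : ‖(inner ℂ g g : ℂ)‖ ≤ √A * ‖g‖ :=
    le_of_tendsto_of_tendsto' (hw g).norm (hn.mul_const _) fun n => norm_inner_le_norm _ _
  rw [inner_self_eq_norm_sq_to_K, norm_pow] at h1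
  have hA0 : 0 ≤ A := ge_of_tendsto' hA fun n => by positivity
  have h2 : ‖g‖ * ‖g‖ ≤ √A * ‖g‖ := by simpa [pow_two] using h1
  have h3 : ‖g‖ ≤ √A := by
    rcases (norm_nonneg g).eq_or_lt with h | h
    · rw [← h]; positivity
    · exact le_of_mul_le_mul_right h2 h
  calc ‖g‖ ^ 2 ≤ √A ^ 2 := by gcongr
    _ = A := Real.sq_sqrt hA0

lemma norm_toLp_sq {v : ℝ → ℂ} (hv : MemLp v 2) :
    ‖hv.toLp v‖ ^ 2 = ∫ x, ‖v x‖ ^ 2 := by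
  have h0 : 0 ≤ ∫ x, ‖v x‖ ^ 2 := integral_nonneg fun x => by positivity
  rw [Lp.norm_toLp, hv.eLpNorm_eq_integral_rpow_norm (by norm_num) (by norm_num)]
  simp only [ENNReal.toReal_ofNat, Real.rpow_ofNat]
  rw [ENNReal.toReal_ofReal (by positivity), ← Real.rpow_natCast, ← Real.rpow_mul h0]
  norm_num

lemma setIntegral_toLp {v : ℝ → ℂ} (hv : MemLp v 2) {s : Set ℝ} (hs : MeasurableSet s) :
    ∫ x in s, hv.toLp v x = ∫ x in s, v x :=
  setIntegral_congr_ae hs (by filter_upwards [hv.coeFn_toLp] with x hx _ using hx)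

/-- A bounded sequence in `L²` has a subsequence whose primitives converge pointwise to the
primitive of a function of no larger norm. -/
lemma exists_subseq_tendsto_intervalIntegral {v : ℕ → ℝ → ℂ} (hv : ∀ n, MemLp (v n) 2) {K : ℝ}
    (hK : ∀ n, ∫ x, ‖v n x‖ ^ 2 ≤ K) :
    ∃ (w : ℝ → ℂ) (φ : ℕ → ℕ), StrictMono φ ∧ MemLp w 2 ∧
      (∀ x y, Tendsto (fun n => ∫ t in x..y, v (φ n) t) atTop (𝓝 (∫ t in x..y, w t))) ∧
      ∀ (θ : ℕ → ℕ) (A : ℝ), Tendsto θ atTop atTop →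
        Tendsto (fun n => ∫ x, ‖v (φ (θ n)) x‖ ^ 2) atTop (𝓝 A) → ∫ x, ‖w x‖ ^ 2 ≤ A := by
  have : Fact ((2 : ℝ≥0∞) ≠ ⊤) := ⟨by norm_num⟩
  obtain ⟨g, φ, hφ, hw⟩ := exists_weakly_convergent_subseq
    (f := fun n => (hv n).toLp (v n)) (r := √K)
    (fun n => Real.le_sqrt_of_sq_le ((norm_toLp_sq (hv n)).trans_le (hK n)))
  refine ⟨g, φ, hφ, Lp.memLp g, fun x y => ?_, fun θ A hθ hA => ?_⟩
  · have hm : volume (uIoc x y) ≠ ⊤ := by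
      rw [uIoc]; exact measure_Ioc_lt_top.ne
    -- Pairing with the indicator of an interval turns weak convergence into convergence of
    -- primitives; conjugation compensates for the antilinear first slot.
    have h1 := (Complex.continuous_conj.tendsto _).comp
      (hw (indicatorConstLp 2 measurableSet_uIoc hm (1 : ℂ)))
    simp only [Function.comp_def, inner_conj_symm, L2.inner_indicatorConstLp_one,
      setIntegral_toLp _ measurableSet_uIoc] at h1
    simp only [intervalIntegral.intervalIntegral_eq_integral_uIoc]
    exact h1.const_smul (if x ≤ y then (1 : ℝ) else -1)
  -- The further subsequence `θ` is needed because the limit `A` of the kinetic energies is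
  -- extracted only afterwards.
  · have h2 := norm_le_of_weak_limit (A := A) (fun h => (hw h).comp hθ) (by simpa only [norm_toLp_sq] using hA)
    have h3 := norm_toLp_sq (Lp.memLp g)
    rw [Lp.toLp_coeFn] at h3
    rwa [← h3]

/-- Dominated convergence with tightness coming from the weight `|x| ^ s`. -/
lemma tendsto_integral_of_tight {s : ℝ} (hs : 0 < s) {f : ℕ → ℝ → ℝ} {g : ℝ → ℝ}
    (hf : ∀ n, Integrable (f n)) (hfm : ∀ n, Measurable (f n)) (hf0 : ∀ n x, 0 ≤ f n x)
    (hg : Measurable g) {C M : ℝ} (hC : ∀ n x, f n x ≤ C) (hM : ∀ n, ∫ x, f n x ≤ M)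
    (hlim : ∀ x, Tendsto (fun n => f n x) atTop (𝓝 (g x))) {K : ℝ≥0∞} (hK : K ≠ ⊤)
    (htight : ∀ n, ∫⁻ x : ℝ, ENNReal.ofReal (|x| ^ s * f n x) ≤ K) :
    Integrable g ∧ Tendsto (fun n => ∫ x, f n x) atTop (𝓝 (∫ x, g x)) := by
  have hg0 : ∀ x, 0 ≤ g x := fun x => ge_of_tendsto' (hlim x) fun n => hf0 n x
  have hlimE : ∀ x, Tendsto (fun n => ENNReal.ofReal (f n x)) atTop (𝓝 (ENNReal.ofReal (g x))) :=
    fun x => (ENNReal.continuous_ofReal.tendsto _).comp (hlim x)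
  have fatou : ∫⁻ x, ENNReal.ofReal (g x) ≤
      liminf (fun n => ∫⁻ x, ENNReal.ofReal (f n x)) atTop := by
    refine le_trans (le_of_eq (lintegral_congr fun x => (hlimE x).liminf_eq.symm)) ?_
    exact lintegral_liminf_le fun n => (hfm n).ennreal_ofReal
  have hint : ∀ n, ∫⁻ x, ENNReal.ofReal (f n x) = ENNReal.ofReal (∫ x, f n x) := fun n =>
    (ofReal_integral_eq_lintegral_ofReal (hf n) (ae_of_all _ (hf0 n))).symm
  have hfin : ∫⁻ x, ENNReal.ofReal (g x) ≤ ENNReal.ofReal M :=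
    fatou.trans (liminf_le_of_frequently_le' (Frequently.of_forall fun n => by
      rw [hint n]; exact ENNReal.ofReal_le_ofReal (hM n)))
  -- Chebyshev: outside `[-R, R]` one has `1 ≤ R^(-s) |x|^s`, uniformly in `n`.
  have tail : ∀ R : ℝ, 0 < R → ∀ n, ∫⁻ x in (Icc (-R) R)ᶜ, ENNReal.ofReal (f n x) ≤
      ENNReal.ofReal (R ^ (-s)) * K := by
    intro R hR n
    calc ∫⁻ x in (Icc (-R) R)ᶜ, ENNReal.ofReal (f n x)
        ≤ ∫⁻ x in (Icc (-R) R)ᶜ, ENNReal.ofReal (R ^ (-s)) *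
            ENNReal.ofReal (|x| ^ s * f n x) := by
          refine setLIntegral_mono' measurableSet_Icc.compl fun x hx => ?_
          rw [← ENNReal.ofReal_mul (by positivity)]
          refine ENNReal.ofReal_le_ofReal ?_
          have hRx : R ≤ |x| := by
            by_contra! hlt
            exact hx ⟨(abs_lt.1 hlt).1.le, (abs_lt.1 hlt).2.le⟩
          have h1 : R ^ s ≤ |x| ^ s := Real.rpow_le_rpow hR.le hRx hs.le
          have h2 : 0 < R ^ s := Real.rpow_pos_of_pos hR s
          rw [Real.rpow_neg hR.le, ← mul_assoc]
          refine le_mul_of_one_le_left (hf0 n x) ?_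
          rw [inv_mul_eq_div, one_le_div h2]
          exact h1
      _ ≤ ∫⁻ x, ENNReal.ofReal (R ^ (-s)) * ENNReal.ofReal (|x| ^ s * f n x) :=
          setLIntegral_le_lintegral _ _
      _ = ENNReal.ofReal (R ^ (-s)) * ∫⁻ x, ENNReal.ofReal (|x| ^ s * f n x) :=
          lintegral_const_mul' _ _ ENNReal.ofReal_ne_top
      _ ≤ _ := by gcongr; exact htight n
  -- On `[-R, R]` the constant `C` dominates; the tail bound controls the rest and disappears as `R
  -- → ∞`.
  have limsup_le : limsup (fun n => ∫⁻ x, ENNReal.ofReal (f n x)) atTop ≤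
      ∫⁻ x, ENNReal.ofReal (g x) := by
    have hR : ∀ R : ℝ, 0 < R → limsup (fun n => ∫⁻ x, ENNReal.ofReal (f n x)) atTop ≤
        (∫⁻ x, ENNReal.ofReal (g x)) + ENNReal.ofReal (R ^ (-s)) * K := by
      intro R hR
      have hd : Tendsto (fun n => ∫⁻ x in Icc (-R) R, ENNReal.ofReal (f n x)) atTop
          (𝓝 (∫⁻ x in Icc (-R) R, ENNReal.ofReal (g x))) := by
        refine tendsto_lintegral_of_dominated_convergence (fun _ => ENNReal.ofReal C)
          (fun n => (hfm n).ennreal_ofReal)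
          (fun n => ae_of_all _ fun x => ENNReal.ofReal_le_ofReal (hC n x)) ?_
          (ae_of_all _ hlimE)
        rw [lintegral_const]
        exact ENNReal.mul_ne_top ENNReal.ofReal_ne_top (by simp)
      have hd' := hd.add_const (ENNReal.ofReal (R ^ (-s)) * K)
      calc _ ≤ limsup (fun n => (∫⁻ x in Icc (-R) R, ENNReal.ofReal (f n x)) +
            ENNReal.ofReal (R ^ (-s)) * K) atTop := by
            refine limsup_le_limsup (Eventually.of_forall fun n => ?_)
            simp only
            rw [← lintegral_add_compl _ (measurableSet_Icc (a := -R) (b := R))]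
            gcongr
            exact tail R hR n
        _ = _ := hd'.limsup_eq
        _ ≤ _ := add_le_add_left (setLIntegral_le_lintegral _ _) _
    have h0 : Tendsto (fun R : ℝ => (∫⁻ x, ENNReal.ofReal (g x)) + ENNReal.ofReal (R ^ (-s)) * K)
        atTop (𝓝 ((∫⁻ x, ENNReal.ofReal (g x)) + ENNReal.ofReal 0 * K)) := by
      refine Tendsto.const_add _ (ENNReal.Tendsto.mul_const ?_ (Or.inr hK))
      exact (ENNReal.continuous_ofReal.tendsto _).comp (tendsto_rpow_neg_atTop hs)
    rw [ENNReal.ofReal_zero, zero_mul, add_zero] at h0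
    exact ge_of_tendsto h0 ((eventually_gt_atTop 0).mono hR)
  have hgi : Integrable g :=
    (lintegral_ofReal_ne_top_iff_integrable hg.aestronglyMeasurable (ae_of_all _ hg0)).1
      (hfin.trans_lt ENNReal.ofReal_lt_top).ne
  refine ⟨hgi, ?_⟩
  have ht := tendsto_of_le_liminf_of_limsup_le fatou limsup_le
  simp only [hint] at ht
  rw [← ofReal_integral_eq_lintegral_ofReal hgi (ae_of_all _ hg0)] at ht
  have := (ENNReal.tendsto_toReal ENNReal.ofReal_ne_top).comp ht
  simpa only [Function.comp_def, ENNReal.toReal_ofReal (integral_nonneg (hf0 _)),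
    ENNReal.toReal_ofReal (integral_nonneg hg0)] using this

/-- Compactness of sequences with bounded kinetic and trapping energy. -/
lemma exists_normalized_limit {s : ℝ} (hs : 0 < s) {u v : ℕ → ℝ → ℂ}
    (h : ∀ n, Normalized (u n) (v n)) {K : ℝ} {T : ℝ≥0∞} (hT : T ≠ ⊤)
    (hK : ∀ n, ∫ x, ‖v n x‖ ^ 2 ≤ K) (htrap : ∀ n, trapEnergy s (u n) ≤ T) :
    ∃ (φ : ℕ → ℕ) (w w' : ℝ → ℂ) (A : ℝ) (P : ℝ≥0∞), StrictMono φ ∧ Normalized w w' ∧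
      Tendsto (fun n => ∫ x, ‖v (φ n) x‖ ^ 2) atTop (𝓝 A) ∧ ∫ x, ‖w' x‖ ^ 2 ≤ A ∧
      Tendsto (fun n => trapEnergy s (u (φ n))) atTop (𝓝 P) ∧ P ≤ T ∧ trapEnergy s w ≤ P ∧
      Tendsto (fun n => ∫ x, ‖u (φ n) x‖ ^ 4) atTop (𝓝 (∫ x, ‖w x‖ ^ 4)) ∧
      Tendsto (fun n => ∫ x, ‖u (φ n) x‖ ^ 6) atTop (𝓝 (∫ x, ‖w x‖ ^ 6)) := by
  have hbound : ∀ n x, ‖u n x‖ ^ 2 ≤ 1 + K := fun n x =>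
    ((h n).norm_sq_le one_pos x).trans (by rw [div_one]; linarith [hK n])
  have hK0 : 0 ≤ 1 + K := (by positivity : (0 : ℝ) ≤ ‖u 0 0‖ ^ 2).trans (hbound 0 0)
  obtain ⟨w', φ₁, hφ₁, hw', hint, hnorm⟩ := exists_subseq_tendsto_intervalIntegral
    (fun n => (h n).memLp_deriv) hK
  -- One extraction yields limits of the kinetic energy, the trapping energy and the value at `0`.
  -- The last fixes the constant of integration left open by convergence of the derivatives'
  -- integrals.
  obtain ⟨⟨A, P, c⟩, hmem, φ₂, hφ₂, hlim⟩ :=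
    ((isCompact_Icc (a := (0 : ℝ)) (b := K)).prod
      ((isCompact_Icc (a := (0 : ℝ≥0∞)) (b := T)).prod
      (isCompact_closedBall (0 : ℂ) √(1 + K)))).tendsto_subseq
    (x := fun n => (∫ x, ‖v (φ₁ n) x‖ ^ 2, trapEnergy s (u (φ₁ n)), u (φ₁ n) 0)) (fun n => by
      refine ⟨⟨integral_nonneg fun x => by positivity, hK _⟩, ⟨zero_le, htrap _⟩, ?_⟩
      rw [mem_closedBall_zero_iff]
      exact Real.le_sqrt_of_sq_le (hbound _ _))
  have lA : Tendsto (fun n => ∫ x, ‖v (φ₁ (φ₂ n)) x‖ ^ 2) atTop (𝓝 A) :=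
    (continuous_fst.tendsto _).comp hlim
  have lP : Tendsto (fun n => trapEnergy s (u (φ₁ (φ₂ n)))) atTop (𝓝 P) :=
    ((continuous_fst.comp continuous_snd).tendsto _).comp hlim
  have lc : Tendsto (fun n => u (φ₁ (φ₂ n)) 0) atTop (𝓝 c) :=
    ((continuous_snd.comp continuous_snd).tendsto _).comp hlim
  set w : ℝ → ℂ := fun x => c + ∫ t in (0 : ℝ)..x, w' t with hw
  have hwP : IsPrimitive w w' := IsPrimitive.of_integral
    (intervalIntegrable_of_locallyIntegrable (hw'.locallyIntegrable (by norm_num))) 0 c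
  have lu : ∀ x, Tendsto (fun n => u (φ₁ (φ₂ n)) x) atTop (𝓝 (w x)) := by
    intro x
    have := lc.add ((hint 0 x).comp hφ₂.tendsto_atTop)
    refine this.congr fun n => ?_
    simp only [Function.comp_apply]
    rw [(h _).isPrimitive.integral_eq]
    ring
  have hconv : ∀ k : ℕ, Integrable (fun x => ‖w x‖ ^ (2 * k + 2)) ∧
      Tendsto (fun n => ∫ x, ‖u (φ₁ (φ₂ n)) x‖ ^ (2 * k + 2)) atTop
        (𝓝 (∫ x, ‖w x‖ ^ (2 * k + 2))) := by
    intro k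
    have hle : ∀ n x, ‖u n x‖ ^ (2 * k + 2) ≤ (1 + K) ^ k * ‖u n x‖ ^ 2 := fun n x => by
      rw [pow_add, pow_mul]
      gcongr
      exact hbound n x
    refine tendsto_integral_of_tight hs (fun n => (h _).integrable_pow k)
      (fun n => ((h _).continuous.norm.pow _).measurable) (fun n x => by positivity)
      (hwP.continuous.norm.pow _).measurable (C := (1 + K) ^ k * (1 + K)) (M := (1 + K) ^ k)
      (fun n x => (hle _ x).trans (by gcongr; exact hbound _ x)) (fun n => ?_)
      (fun x => (lu x).norm.pow _) (K := ENNReal.ofReal ((1 + K) ^ k) * T)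
      (ENNReal.mul_ne_top ENNReal.ofReal_ne_top hT) (fun n => ?_)
    · calc _ ≤ ∫ x, (1 + K) ^ k * ‖u (φ₁ (φ₂ n)) x‖ ^ 2 :=
            integral_mono ((h _).integrable_pow k) ((h _).integrable_sq.const_mul _) (hle _)
        _ = _ := by rw [integral_const_mul, (h _).integral_norm_sq, mul_one]
    · calc _ ≤ ∫⁻ x, ENNReal.ofReal ((1 + K) ^ k) *
            ENNReal.ofReal (|x| ^ s * ‖u (φ₁ (φ₂ n)) x‖ ^ 2) := by
            refine lintegral_mono fun x => ?_
            rw [← ENNReal.ofReal_mul (by positivity)]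
            refine ENNReal.ofReal_le_ofReal ?_
            rw [mul_left_comm]
            gcongr
            exact hle _ x
        _ = ENNReal.ofReal ((1 + K) ^ k) * trapEnergy s (u (φ₁ (φ₂ n))) :=
            lintegral_const_mul' _ _ ENNReal.ofReal_ne_top
        _ ≤ _ := by gcongr; exact htrap _
  -- The case `k = 0` says that no mass is lost in the limit.
  have hw2 := hconv 0
  simp only [mul_zero, zero_add, (h _).integral_norm_sq] at hw2
  refine ⟨φ₁ ∘ φ₂, w, w', A, P, hφ₁.comp hφ₂, ⟨?_, hw', hwP, ?_⟩, lA, ?_, lP, hmem.2.1.2, ?_,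
    (hconv 1).2, (hconv 2).2⟩
  · exact (memLp_two_iff_integrable_sq_norm hwP.continuous.aestronglyMeasurable).2 hw2.1
  · exact tendsto_nhds_unique hw2.2 tendsto_const_nhds
  · exact hnorm φ₂ A hφ₂.tendsto_atTop lA
  · have e : ∀ x : ℝ, ENNReal.ofReal (|x| ^ s * ‖w x‖ ^ 2) = liminf (fun n =>
        ENNReal.ofReal (|x| ^ s * ‖u (φ₁ (φ₂ n)) x‖ ^ 2)) atTop := fun x =>
      ((ENNReal.continuous_ofReal.tendsto _).comp
        (((lu x).norm.pow 2).const_mul _)).liminf_eq.symm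
    rw [← lP.liminf_eq, trapEnergy, lintegral_congr e]
    refine lintegral_liminf_le fun n => ?_
    have := (h (φ₁ (φ₂ n))).continuous
    exact (Continuous.mul (continuous_abs.rpow_const fun _ => Or.inr hs.le)
      (by fun_prop)).measurable.ennreal_ofReal

/-! ### A priori bounds and existence of ground states -/

lemma criticalMass_pos : 0 < criticalMass := by
  rw [criticalMass]; positivity

namespace Normalized

variable {u v : ℝ → ℂ}

lemma integral_pow_four_le (h : Normalized u v) {t : ℝ} (ht : 0 < t) :
    ∫ x, ‖u x‖ ^ 4 ≤ t + (∫ x, ‖v x‖ ^ 2) / t := by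
  calc ∫ x, ‖u x‖ ^ 4 ≤ ∫ x, (t + (∫ x, ‖v x‖ ^ 2) / t) * ‖u x‖ ^ 2 := by
        refine integral_mono h.integrable_pow_four (h.integrable_sq.const_mul _) fun x => ?_
        calc ‖u x‖ ^ 4 = ‖u x‖ ^ 2 * ‖u x‖ ^ 2 := by ring
          _ ≤ _ := by gcongr; exact h.norm_sq_le ht x
    _ = _ := by rw [integral_const_mul, h.integral_norm_sq, mul_one]

lemma integral_pow_six_le (h : Normalized u v) {t : ℝ} (ht : 0 < t) :
    ∫ x, ‖u x‖ ^ 6 ≤ (t + (∫ x, ‖v x‖ ^ 2) / t) * ∫ x, ‖u x‖ ^ 4 := by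
  rw [← integral_const_mul]
  refine integral_mono h.integrable_pow_six (h.integrable_pow_four.const_mul _) fun x => ?_
  calc ‖u x‖ ^ 6 = ‖u x‖ ^ 2 * ‖u x‖ ^ 4 := by ring
    _ ≤ _ := by gcongr; exact h.norm_sq_le ht x

end Normalized

/-- The kinetic and trapping energies are controlled by the total energy. -/
lemma exists_bound_of_subcritical {a b : ℝ} (hb : 0 < b) (hab : b < criticalMass) (C : ℝ) :
    ∃ K : ℝ, ∀ u v : ℝ → ℂ, Normalized u v → ∀ t : ℝ, 0 ≤ t →
      untrappedEnergy a b u v + t ≤ C → (∫ x, ‖v x‖ ^ 2) ≤ K ∧ t ≤ K := by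
  have hm := criticalMass_pos
  -- `δ` is the fraction of kinetic energy left after the sextic term is absorbed. The choice of `r`
  -- lets the quartic term consume at most half of it; the `+ 1` keeps `r` positive when `a = 0`.
  set δ := 1 - b / criticalMass with hδ
  have hδ0 : 0 < δ := by
    rw [hδ, sub_pos, div_lt_one hm]; exact hab
  set r := (|a| + 1) / δ with hr
  have hr0 : 0 < r := by positivity
  refine ⟨max (2 / δ * (C + |a| / 2 * r)) (C + |a| / 2 * r), fun u v h t ht hE => ?_⟩
  rw [untrappedEnergy] at hE
  have h4 := h.integral_pow_four_le hr0
  have hGN := h.gagliardo_nirenberg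
  have hA : 0 ≤ ∫ x, ‖v x‖ ^ 2 := integral_nonneg fun x => by positivity
  have hD : 0 ≤ ∫ x, ‖u x‖ ^ 4 := integral_nonneg fun x => by positivity
  generalize (∫ x, ‖v x‖ ^ 2) = A at *
  generalize (∫ x, ‖u x‖ ^ 4) = D at *
  generalize (∫ x, ‖u x‖ ^ 6) = B at *
  have e1 : b / 6 * B ≤ (1 - δ) * A := by
    have : b / 6 * B = b / criticalMass * (criticalMass / 6 * B) := by field_simp
    rw [this, hδ, sub_sub_cancel]
    gcongr
  have e2 : -(|a| / 2 * D) ≤ a / 2 * D := by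
    have := mul_le_mul_of_nonneg_right (neg_abs_le a) hD
    linarith
  have e3 : |a| / 2 * D ≤ |a| / 2 * r + δ / 2 * A := by
    have f1 : |a| / 2 * D ≤ |a| / 2 * (r + A / r) := by gcongr
    have f2 : |a| / 2 * (A / r) ≤ δ / 2 * A := by
      rw [hr, div_div_eq_mul_div, mul_div_assoc', div_le_iff₀ (by positivity)]
      nlinarith [mul_nonneg hA hδ0.le]
    linarith
  have e4 : δ / 2 * A + t ≤ C + |a| / 2 * r := by linarith
  have e5 : 0 ≤ δ / 2 * A := by positivity
  constructor
  · refine le_max_of_le_left ?_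
    rw [div_mul_eq_mul_div, le_div_iff₀ hδ0]
    linarith
  · exact le_max_of_le_right (by linarith)

/-- The sharp inequality leaves no kinetic energy to spare, but it bounds `∫ |u|⁴` by `2|C|/a`. Then
`∫ |u|⁶ ≤ sup |u|² ∫ |u|⁴` makes the sextic term at most half the kinetic energy plus a constant,
for `r` large. -/
lemma exists_bound_of_critical {a : ℝ} (ha : 0 < a) (C : ℝ) :
    ∃ K : ℝ, ∀ u v : ℝ → ℂ, Normalized u v → ∀ t : ℝ, 0 ≤ t →
      untrappedEnergy a criticalMass u v + t ≤ C → (∫ x, ‖v x‖ ^ 2) ≤ K ∧ t ≤ K := by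
  have hm := criticalMass_pos
  set r := criticalMass / 3 * (2 * |C| / a) + 1 with hr
  have hr0 : 0 < r := by positivity
  refine ⟨max (2 * (C + criticalMass / 6 * (r * (2 * |C| / a)))) C, fun u v h t ht hE => ?_⟩
  rw [untrappedEnergy] at hE
  have h6 := h.integral_pow_six_le hr0
  have hGN := h.gagliardo_nirenberg
  have hA : 0 ≤ ∫ x, ‖v x‖ ^ 2 := integral_nonneg fun x => by positivity
  have hD : 0 ≤ ∫ x, ‖u x‖ ^ 4 := integral_nonneg fun x => by positivity
  generalize (∫ x, ‖v x‖ ^ 2) = A at *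
  generalize (∫ x, ‖u x‖ ^ 4) = D at *
  generalize (∫ x, ‖u x‖ ^ 6) = B at *
  have haD : 0 ≤ a / 2 * D := by positivity
  have e1 : D ≤ 2 * |C| / a := by
    rw [le_div_iff₀ ha]
    linarith [le_abs_self C]
  generalize 2 * |C| / a = q at *
  have hq : 0 ≤ q := hD.trans e1
  have e2 : B ≤ (r + A / r) * q := h6.trans (by gcongr)
  have e3 : criticalMass / 6 * (A / r * q) ≤ A / 2 := by
    have : criticalMass / 6 * (A / r * q) = A / 2 * (criticalMass / 3 * q / r) := by
      field_simp; ring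
    rw [this]
    refine mul_le_of_le_one_right (by positivity) ?_
    rw [div_le_one hr0, hr]
    linarith
  have e4 : criticalMass / 6 * B ≤ criticalMass / 6 * (r * q) + A / 2 := by
    calc _ ≤ criticalMass / 6 * ((r + A / r) * q) := by gcongr
      _ = criticalMass / 6 * (r * q) + criticalMass / 6 * (A / r * q) := by ring
      _ ≤ _ := by gcongr
  constructor
  · exact le_max_of_le_left (by linarith)
  · exact le_max_of_le_right (by linarith)

lemma Admissible.exists_energy_eq {u : ℝ → ℂ} (h : Admissible u) (s a b : ℝ) :
    ∃ w v : ℝ → ℂ, Normalized w v ∧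
      energy s a b u = (untrappedEnergy a b w v : EReal) + (trapEnergy s w : EReal) := by
  obtain ⟨w, v, hwu, hw⟩ := h.exists_normalized
  exact ⟨w, v, hw, (energy_congr_ae hwu s a b).symm.trans (hw.energy_eq s a b)⟩

lemma groundStateEnergy_le {s a b : ℝ} {u : ℝ → ℂ} (h : Admissible u) :
    groundStateEnergy s a b ≤ energy s a b u :=
  sInf_le ⟨u, h, rfl⟩

/-- The direct method; in `hbound`, `t` stands for the trapping energy. -/
lemma exists_isGroundState_of_bound {s a b : ℝ} (hs : 0 < s)
    (hbound : ∀ C : ℝ, ∃ K : ℝ, ∀ u v : ℝ → ℂ, Normalized u v → ∀ t : ℝ, 0 ≤ t →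
      untrappedEnergy a b u v + t ≤ C → (∫ x, ‖v x‖ ^ 2) ≤ K ∧ t ≤ K) :
    ∃ u : ℝ → ℂ, IsGroundState s a b u := by
  have hsol := (normalized_soliton one_pos).admissible
  obtain ⟨e, -, he, hmem⟩ := exists_seq_tendsto_sInf
    (S := energy s a b '' {u | Admissible u}) ⟨_, _, hsol, rfl⟩ (OrderBot.bddBelow _)
  have hfin := energy_soliton hs a b one_pos
  set c := (criticalMass - b) / 12 * 1 ^ 2 + a / 2 * (∫ x, solitonDensity x ^ 2) * 1 +
    1 ^ (-s) * ∫ x : ℝ, |x| ^ s * solitonDensity x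
  have hlt : groundStateEnergy s a b < ((c + 1 : ℝ) : EReal) :=
    (groundStateEnergy_le hsol).trans_lt (by
      rw [hfin]; exact EReal.coe_lt_coe_iff.2 (lt_add_one c))
  -- Dropping `N` terms keeps all energies below `c + 1`, hence all trapping energies finite.
  obtain ⟨N, hN⟩ := eventually_atTop.1 (he.eventually (gt_mem_nhds hlt))
  have hseq : ∀ n, ∃ w v : ℝ → ℂ, Normalized w v ∧
      e (n + N) = (untrappedEnergy a b w v : EReal) + (trapEnergy s w : EReal) := by
    intro n
    obtain ⟨u, hu, hue⟩ := hmem (n + N)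
    rw [← hue]
    exact Admissible.exists_energy_eq hu s a b
  choose w v hw hwe using hseq
  have htop : ∀ n, trapEnergy s (w n) ≠ ⊤ := by
    intro n hn
    have := hN (n + N) (by omega)
    rw [hwe n, hn, EReal.coe_ennreal_top, EReal.coe_add_top] at this
    exact not_top_lt this
  have hreal : ∀ n, e (n + N) =
      ((untrappedEnergy a b (w n) (v n) + (trapEnergy s (w n)).toReal : ℝ) : EReal) := by
    intro n
    rw [hwe n, EReal.coe_add, EReal.coe_ennreal_toReal (htop n)]
  obtain ⟨K, hK⟩ := hbound (c + 1)
  have hKn : ∀ n, (∫ x, ‖v n x‖ ^ 2) ≤ K ∧ (trapEnergy s (w n)).toReal ≤ K := fun n =>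
    hK _ _ (hw n) _ ENNReal.toReal_nonneg (by
      have := hN (n + N) (by omega)
      rw [hreal n] at this
      exact (EReal.coe_lt_coe_iff.1 this).le)
  obtain ⟨φ, z, z', A, P, hφ, hz, lA, hA, lP, hPT, hP, l4, l6⟩ := exists_normalized_limit hs hw
    (T := ENNReal.ofReal K) ENNReal.ofReal_ne_top (fun n => (hKn n).1) fun n => by
      rw [← ENNReal.ofReal_toReal (htop n)]
      exact ENNReal.ofReal_le_ofReal (hKn n).2
  have hPtop : P ≠ ⊤ := (hPT.trans_lt ENNReal.ofReal_lt_top).ne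
  set L := A + a / 2 * (∫ x, ‖z x‖ ^ 4) - b / 6 * ∫ x, ‖z x‖ ^ 6 with hL
  have hlim : Tendsto (fun n => e (φ n + N)) atTop (𝓝 ((L + P.toReal : ℝ) : EReal)) := by
    simp only [hreal]
    refine (continuous_coe_real_ereal.tendsto _).comp ?_
    exact ((lA.add (l4.const_mul _)).sub (l6.const_mul _)).add
      ((ENNReal.tendsto_toReal hPtop).comp lP)
  have he' : Tendsto (fun n => e (φ n + N)) atTop (𝓝 (groundStateEnergy s a b)) :=
    he.comp ((tendsto_add_atTop_nat N).comp hφ.tendsto_atTop)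
  refine ⟨z, hz.admissible, le_antisymm ?_ (groundStateEnergy_le hz.admissible)⟩
  rw [tendsto_nhds_unique he' hlim, hz.energy_eq, EReal.coe_add, EReal.coe_ennreal_toReal hPtop]
  refine add_le_add (EReal.coe_le_coe_iff.2 ?_) (EReal.coe_ennreal_le_coe_ennreal_iff.2 hP)
  rw [untrappedEnergy, hL]
  linarith

/-! ### Collapse, and the critical case without quartic term -/

lemma groundStateEnergy_eq_bot {s a b : ℝ} (hs : 0 < s)
    (h : criticalMass < b ∨ (b = criticalMass ∧ a < 0)) : groundStateEnergy s a b = ⊥ := by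
  set D := ∫ x, solitonDensity x ^ 2 with hD
  have hD0 : 0 < D := integral_solitonDensity_sq_pos
  have hmain : Tendsto (fun τ : ℝ => (criticalMass - b) / 12 * τ ^ 2 + a / 2 * D * τ)
      atTop atBot := by
    rcases h with h | ⟨rfl, ha⟩
    · have h1 : Tendsto (fun τ : ℝ => (criticalMass - b) / 12 * τ + a / 2 * D) atTop atBot :=
        tendsto_atBot_add_const_right _ _
          (tendsto_id.const_mul_atTop_of_neg (by linarith : (criticalMass - b) / 12 < 0))
      refine (tendsto_id.atTop_mul_atBot₀ h1).congr fun τ => ?_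
      simp only [id]
      ring
    · simp only [sub_self, zero_div, zero_mul, zero_add]
      exact tendsto_id.const_mul_atTop_of_neg (by nlinarith)
  have htot := hmain.atBot_add
    ((tendsto_rpow_neg_atTop hs).mul_const (∫ x : ℝ, |x| ^ s * solitonDensity x))
  refine eq_bot_iff.2 (EReal.le_of_forall_lt_iff_le.1 fun z _ => ?_)
  obtain ⟨τ, hτ, hτ0⟩ := ((htot.eventually_le_atBot z).and (eventually_gt_atTop 0)).exists
  refine (groundStateEnergy_le (normalized_soliton hτ0).admissible).trans ?_
  rw [energy_soliton hs a b hτ0]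
  exact EReal.coe_le_coe_iff.2 hτ

lemma Normalized.untrappedEnergy_nonneg {u v : ℝ → ℂ} (h : Normalized u v) :
    0 ≤ untrappedEnergy 0 criticalMass u v := by
  have := h.gagliardo_nirenberg
  rw [untrappedEnergy]
  linarith

/-- The weight vanishes only at the origin, so zero trapping energy would force `u = 0` almost
everywhere, against unit mass. -/
lemma Normalized.trapEnergy_ne_zero {u v : ℝ → ℂ} (h : Normalized u v) {s : ℝ} (hs : 0 < s) :
    trapEnergy s u ≠ 0 := by
  intro h0
  have hc := h.continuous
  have hm : Measurable fun x : ℝ => ENNReal.ofReal (|x| ^ s * ‖u x‖ ^ 2) :=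
    (Continuous.mul (continuous_abs.rpow_const fun _ => Or.inr hs.le)
      (by fun_prop)).measurable.ennreal_ofReal
  rw [trapEnergy, lintegral_eq_zero_iff hm] at h0
  have h1 : ∫ x, ‖u x‖ ^ 2 = ∫ _ : ℝ, (0 : ℝ) := by
    refine integral_congr_ae ?_
    have hne : ∀ᵐ x : ℝ, x ≠ 0 := by simp [ae_iff, measure_singleton]
    filter_upwards [h0, hne] with x hx hx0
    have hp : 0 < |x| ^ s := Real.rpow_pos_of_pos (abs_pos.2 hx0) s
    have h2 : |x| ^ s * ‖u x‖ ^ 2 ≤ 0 := ENNReal.ofReal_eq_zero.1 hx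
    exact le_antisymm (nonpos_of_mul_nonpos_right h2 hp) (by positivity)
  rw [h.integral_norm_sq, integral_zero] at h1
  exact one_ne_zero h1

lemma groundStateEnergy_critical {s : ℝ} (hs : 0 < s) :
    groundStateEnergy s 0 criticalMass = 0 := by
  refine le_antisymm ?_ (le_sInf ?_)
  · have hlim : Tendsto (fun τ : ℝ =>
        ((τ ^ (-s) * ∫ x : ℝ, |x| ^ s * solitonDensity x : ℝ) : EReal)) atTop (𝓝 0) := by
      have := (tendsto_rpow_neg_atTop hs).mul_const (∫ x : ℝ, |x| ^ s * solitonDensity x)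
      rw [zero_mul] at this
      exact (continuous_coe_real_ereal.tendsto 0).comp this
    refine ge_of_tendsto hlim ((eventually_gt_atTop 0).mono fun τ hτ => ?_)
    refine (groundStateEnergy_le (normalized_soliton hτ).admissible).trans_eq ?_
    rw [energy_soliton hs 0 criticalMass hτ]
    simp
  · rintro _ ⟨u, hu, rfl⟩
    obtain ⟨w, v, hw, he⟩ := Admissible.exists_energy_eq hu s 0 criticalMass
    rw [he]
    exact add_nonneg (EReal.coe_nonneg.2 hw.untrappedEnergy_nonneg) (EReal.coe_ennreal_nonneg _)

lemma not_isGroundState_critical {s : ℝ} (hs : 0 < s) (u : ℝ → ℂ) :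
    ¬ IsGroundState s 0 criticalMass u := by
  rintro ⟨hu, hE⟩
  obtain ⟨w, v, hw, he⟩ := hu.exists_energy_eq s 0 criticalMass
  rw [groundStateEnergy_critical hs, he] at hE
  have h1 : (trapEnergy s w : EReal) ≤ 0 := by
    rw [← hE]
    exact le_add_of_nonneg_left (EReal.coe_nonneg.2 hw.untrappedEnergy_nonneg)
  have h2 : trapEnergy s w ≤ 0 := by
    rwa [← EReal.coe_ennreal_zero, EReal.coe_ennreal_le_coe_ennreal_iff] at h1
  exact hw.trapEnergy_ne_zero hs (le_antisymm h2 zero_le)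

end NLS

theorem theorem1 (s a b : ℝ) (hs : 0 < s) (hb : 0 < b) :
    (NLS.criticalMass < b ∨ (b = NLS.criticalMass ∧ a < 0) →
      NLS.groundStateEnergy s a b = ⊥) ∧
    (b < NLS.criticalMass ∨ (b = NLS.criticalMass ∧ 0 < a) →
      ∃ u : ℝ → ℂ, NLS.IsGroundState s a b u) ∧
    (b = NLS.criticalMass ∧ a = 0 →
      NLS.groundStateEnergy s a b = 0 ∧ ¬ ∃ u : ℝ → ℂ, NLS.IsGroundState s a b u) := by
  refine ⟨NLS.groundStateEnergy_eq_bot hs, ?_, ?_⟩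
  · rintro (h | ⟨rfl, ha⟩)
    · exact NLS.exists_isGroundState_of_bound hs (NLS.exists_bound_of_subcritical hb h)
    · exact NLS.exists_isGroundState_of_bound hs (NLS.exists_bound_of_critical ha)
  · rintro ⟨rfl, rfl⟩
    exact ⟨NLS.groundStateEnergy_critical hs, fun ⟨u, hu⟩ => NLS.not_isGroundState_critical hs u hu⟩
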